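/- \textbf{Setting.} Let $m\ge 2$ and write $W_j^*=\mathbb{R}^2$ for $j=1,\dots,m$. For $w\in\mathbb{R}^2$ let $\mathrm{ins}_j\big(w\otimes(1,0)^{\otimes(m-1)}\big)\in\bigotimes_{i=1}^m W_i^*$ denote the decomposable tensor with $w$ in the $j$-th slot and $(1,0)$ in every other slot. The product Segre factorization structure is the inclusion $\varphi$ of the $(m+1)$-dimensional space $$\mathfrak h=\sum_{j=1}^m \mathrm{ins}_j\big(W_j^*\otimes\langle(1,0)^{\otimes(m-1)}\rangle\big)\subset\bigotimes_{i=1}^m W_i^* .$$ For $x\in\mathbb{R}^m$ let $\mu=\mu(x)\in\mathfrak h^*$ be the contraction with $(1,x_1)\otimes\cdots\otimes(1,x_m)$. Let $I_1,\dots,I_m\subset\mathbb{R}$ be non-empty open intervals, let $\beta\in\mathfrak h$ be such that $\langle\mu,\beta\rangle$ has no zero on $I_1\times\cdots\times I_m$, and let $A_j:I_j\to\mathbb{R}$ be smooth and nowhere zero. Put $\mathfrak t=\mathfrak h/\langle\beta\rangle$, $\mu_\beta=\mu/\langle\mu,\beta\rangle$ and $\theta_j=\langle\partial_{x_j}\mu_\beta,dt\rangle$,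 where $t$ is the $\mathfrak t$-valued coordinate. The twisted product of Riemann surfaces is the (possibly indefinite) Kähler geometry $$g_\beta=\sum_{j=1}^m\Big(\frac{dx_j^2}{A_j(x_j)\langle\mu,\beta\rangle}+A_j(x_j)\langle\mu,\beta\rangle\,\theta_j^2\Big),\qquad \omega_\beta=\sum_{j=1}^m dx_j\wedge\theta_j$$ on $I_1\times\cdots\times I_m\times\mathfrak t$. It is extremal if its scalar curvature is a Killing potential, i.e. the $\omega_\beta$-Hamiltonian vector field of the scalar curvature is a Killing vector field of $g_\beta$. \textbf{Theorem.} The twisted product of Riemann surfaces is extremal if and only if one of the following holds (all formulas for $A_i$ being on $I_i$). \begin{enumerate} \item $\varphi(\beta)=t\cdot(1,0)^{\otimes m}$ with $t\in\mathbb{R}\setminus\{0\}$ (i.e. $\langle\mu,\beta\rangle=t$), and every $A_i$ is a polynomial of degree at most $3$. \item $\varphi(\beta)=\mathrm{ins}_j\big((a,b)\otimes(1,0)^{\otimes(m-1)}\big)$ for some $j$ and some $a,b\in\mathbb{R}$ with $b\neq0$ (i.e. $\langle\mu,\beta\rangle=a+bx_j$), and there is a polynomial $\Upsilon(x)=\gamma_0+\gamma_1x+\gamma_2x^2$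 such that $$A_j(x_j)=(a+bx_j)^{m+1}\int\!\!\int\frac{\Upsilon(x_j)}{(a+bx_j)^{m+3}}\,dx_j\,dx_j$$ for some choice of the constants of integration, every $A_i$ with $i\neq j$ is a polynomial of degree at most $2$, and $$\gamma_2+b^2\sum_{i\neq j}A_i''=0 .$$ \item There are $S\subset\{1,\dots,m\}$ with $|S|\ge2$ and vectors $(a_j,b_j)$, $b_j\ne0$, $j\in S$, such that $\varphi(\beta)=\sum_{j\in S}\mathrm{ins}_j\big((a_j,b_j)\otimes(1,0)^{\otimes(m-1)}\big)$ (i.e. $\langle\mu,\beta\rangle=\beta_0+\sum_{j\in S}\beta_jx_j$ with $\beta_0=\sum_{j\in S}a_j$ and $\beta_j=b_j$), and either \begin{enumerate} \item $m=2$ and $A_j(x_j)=\sum_{r=0}^4a_{jr}x_j^r$, $j=1,2$, with real coefficients satisfying $$a_{24}=-\frac{\beta_2^2}{\beta_1^2}a_{14},\qquad a_{23}=-4\frac{\beta_0\beta_2}{\beta_1^2}a_{14}+\frac{\beta_2}{\beta_1}a_{13},\qquad a_{22}=-6\frac{\beta_0^2}{\beta_1^2}a_{14}+3\frac{\beta_0}{\beta_1}a_{13}-a_{12},$$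 or \item $m\ge3$, $A_j$ is a polynomial of degree at most $1$ for every $j\in S$, $A_r$ is a polynomial of degree at most $2$ for every $r\notin S$, and $\sum_{r\notin S}A_r''=0$. \end{enumerate} \end{enumerate} Moreover, in case (2), $A_j(x_j)=\bar\Upsilon(x_j)+(a+bx_j)^{m+1}(\nu^0+\nu^1x_j)$ for some polynomial $\bar\Upsilon$ with $\deg\bar\Upsilon\le2$ and some $\nu^0,\nu^1\in\mathbb{R}$. -/

import Mathlib

open scoped TensorProduct ContDiff

noncomputable section

/-! ### Riemannian geometry in a chart

`ι` indexes the coordinates of a chart, a point is `p : ι → ℝ`, and a metric (or any field of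
bilinear forms) is given by its matrix of components. -/

namespace Chart

variable {ι : Type} [Fintype ι] [DecidableEq ι]

/-- The partial derivative `∂f/∂pᵢ`. -/
def pd (i : ι) (f : (ι → ℝ) → ℝ) (p : ι → ℝ) : ℝ :=
  fderiv ℝ f p (Pi.single i 1)

/-- The Christoffel symbol `Γᵃ_{bc}` of the Levi-Civita connection of `g`. -/
def christoffel (g : (ι → ℝ) → Matrix ι ι ℝ) (a b c : ι) (p : ι → ℝ) : ℝ :=
  (1 / 2) * ∑ d, (g p)⁻¹ a d *
    (pd b (fun q => g q d c) p + pd c (fun q => g q d b) p - pd d (fun q => g q b c) p)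

/-- The component `Ric_{bc}` of the Ricci tensor of `g`. -/
def ricci (g : (ι → ℝ) → Matrix ι ι ℝ) (b c : ι) (p : ι → ℝ) : ℝ :=
  (∑ a, (pd a (christoffel g a b c) p - pd b (christoffel g a a c) p)) +
    ∑ a, ∑ d, (christoffel g a a d p * christoffel g d b c p -
      christoffel g a b d p * christoffel g d a c p)

/-- The scalar curvature of `g`. -/
def scalarCurvature (g : (ι → ℝ) → Matrix ι ι ℝ) (p : ι → ℝ) : ℝ :=
  ∑ b, ∑ c, (g p)⁻¹ b c * ricci g b c p

/-- The component `(ℒ_K g)_{bc}` of the Lie derivative of `g` along the vector field `K`. -/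
def lieDerivative (K : (ι → ℝ) → ι → ℝ) (g : (ι → ℝ) → Matrix ι ι ℝ) (b c : ι) (p : ι → ℝ) : ℝ :=
  ∑ a, (K p a * pd a (fun q => g q b c) p + g p a c * pd b (fun q => K q a) p +
    g p b a * pd c (fun q => K q a) p)

/-- `f` is a Killing potential on `M` for the metric `g` and the symplectic form `Ω`: the
Hamiltonian vector field of `f`, i.e. the vector field `K` with `Ω(K, ·) = -df` (equivalently
`± J grad f` when `(g, J, Ω)` is Kähler), is a Killing vector field of `g`. -/
def IsKillingPotential (g Ω : (ι → ℝ) → Matrix ι ι ℝ) (M : Set (ι → ℝ)) (f : (ι → ℝ) → ℝ) : Prop :=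
  ∃ K : (ι → ℝ) → ι → ℝ, ContDiffOn ℝ ∞ K M ∧
    (∀ p ∈ M, ∀ b, ∑ a, Ω p a b * K p a = -pd b f p) ∧
    (∀ p ∈ M, ∀ b c, lieDerivative K g b c p = 0)

/-- A Kähler geometry with metric `g` and symplectic form `Ω` is extremal on `M` if its scalar
curvature is a Killing potential. -/
def IsExtremal (g Ω : (ι → ℝ) → Matrix ι ι ℝ) (M : Set (ι → ℝ)) : Prop :=
  IsKillingPotential g Ω M (scalarCurvature g)

end Chart

/-! ### The product Segre factorization structure -/

/-- `W₁* ⊗ ⋯ ⊗ W_m*` with every 2-dimensional space `W_j*` identified with `ℝ²`, in such a way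
that the distinguished line `a^j ⊂ W_j*` is spanned by `(1, 0)`. -/
abbrev SegreTensor (m : ℕ) : Type := ⨂[ℝ] _j : Fin m, (Fin 2 → ℝ)

/-- `w ↦ ins_j (w ⊗ (1,0)^{⊗(m-1)})`: the vector `w` is put in the `j`-th slot, and `(1,0)` in
every other slot. -/
def segreIns {m : ℕ} (j : Fin m) : (Fin 2 → ℝ) →ₗ[ℝ] SegreTensor m :=
  (PiTensorProduct.tprod ℝ).toLinearMap (fun _ => ![1, 0]) j

/-- The product Segre factorization structure
`𝔥 = ∑_j ins_j (W_j* ⊗ ⟨(1,0)^{⊗(m-1)}⟩) ↪ W₁* ⊗ ⋯ ⊗ W_m*`. -/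
def productSegre (m : ℕ) : Submodule ℝ (SegreTensor m) :=
  ⨆ j : Fin m, LinearMap.range (segreIns j)

/-- The contraction of a tensor with `(1, x₁) ⊗ ⋯ ⊗ (1, x_m)`. -/
def segreContract {m : ℕ} (x : Fin m → ℝ) : SegreTensor m →ₗ[ℝ] ℝ :=
  PiTensorProduct.lift
    ((MultilinearMap.mkPiAlgebra ℝ (Fin m) ℝ).compLinearMap
      (fun j => LinearMap.proj (0 : Fin 2) + x j • LinearMap.proj (1 : Fin 2)))

/-- The momentum map `μ = φᵗ ((1, x₁) ⊗ ⋯ ⊗ (1, x_m)) ∈ 𝔥*`. -/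
def segreMu {m : ℕ} (x : Fin m → ℝ) : productSegre m →ₗ[ℝ] ℝ :=
  (segreContract x).comp (productSegre m).subtype

/-! ### The twisted product of Riemann surfaces

Let `e = (β, e₁, …, e_m)` be a basis of `𝔥` whose first vector is `β`. The classes of
`e₁, …, e_m` form a basis of `𝔱 = 𝔥 / ⟨β⟩`, and `t₁, …, t_m` are the corresponding linear
coordinates of `t`. The geometry lives in the coordinates `(x₁, …, x_m, t₁, …, t_m)`, indexed by
`Fin m ⊕ Fin m`. -/

namespace TwistedProduct

variable {m : ℕ}

/-- The matrix of coefficients of the one-forms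
`θ_j = ⟨∂_{x_j} μ_β, dt⟩ = ∑_r ∂_{x_j} ⟨μ_β, e_r⟩ dt_r`, where `μ_β = μ / ⟨μ, β⟩` and `β = e₀`. -/
def theta (e : Module.Basis (Fin (m + 1)) ℝ (productSegre m)) (x : Fin m → ℝ) :
    Matrix (Fin m) (Fin m) ℝ :=
  Matrix.of fun j r => Chart.pd j (fun y => segreMu y (e r.succ) / segreMu y (e 0)) x

/-- The metric
`g_β = ∑_j (dx_j² / (A_j(x_j) ⟨μ, β⟩) + A_j(x_j) ⟨μ, β⟩ θ_j²)`, where `β = e₀`. -/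
def metric (e : Module.Basis (Fin (m + 1)) ℝ (productSegre m)) (A : Fin m → ℝ → ℝ)
    (p : Fin m ⊕ Fin m → ℝ) : Matrix (Fin m ⊕ Fin m) (Fin m ⊕ Fin m) ℝ :=
  let x : Fin m → ℝ := fun j => p (Sum.inl j)
  Matrix.fromBlocks
    (Matrix.diagonal fun j => 1 / (A j (x j) * segreMu x (e 0))) 0
    0 (Matrix.of fun r s =>
      ∑ j, A j (x j) * segreMu x (e 0) * (theta e x j r * theta e x j s))

/-- The symplectic form `ω_β = ∑_j dx_j ∧ θ_j`. -/
def symplecticForm (e : Module.Basis (Fin (m + 1)) ℝ (productSegre m))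
    (p : Fin m ⊕ Fin m → ℝ) : Matrix (Fin m ⊕ Fin m) (Fin m ⊕ Fin m) ℝ :=
  let x : Fin m → ℝ := fun j => p (Sum.inl j)
  Matrix.fromBlocks 0 (theta e x) (-(theta e x).transpose) 0

/-- The domain `I₁ × ⋯ × I_m × ℝ^m` of the coordinates `(x, t)`. -/
def domain (I : Fin m → Set ℝ) : Set (Fin m ⊕ Fin m → ℝ) :=
  {p | ∀ j, p (Sum.inl j) ∈ I j}

end TwistedProduct

/-- On `I`, the function `f` is given by a polynomial of degree at most `d`. -/
def IsPolynomialOn (d : ℕ) (f : ℝ → ℝ) (I : Set ℝ) : Prop :=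
  ∃ q : Polynomial ℝ, q.natDegree ≤ d ∧ ∀ x ∈ I, f x = q.eval x

/-- On `I`, the function `F` is a value of the indefinite double integral `∫∫ f(x) dx dx`. -/
def IsDoubleIntegralOn (F f : ℝ → ℝ) (I : Set ℝ) : Prop :=
  ∃ G : ℝ → ℝ, (∀ x ∈ I, HasDerivAt F (G x) x) ∧ (∀ x ∈ I, HasDerivAt G (f x) x)

/-- The conditions on the functions `A` when `⟨μ, β⟩ = a + b x_j`, for the polynomial
`Υ(x) = γ₀ + γ₁ x + γ₂ x²`: `A_j` is `(a + b x)^{m+1} ∫∫ Υ / (a + b x)^{m+3}`, the other `A_i`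
are polynomials of degree at most 2, and `γ₂ + b² ∑_{i ≠ j} A_i'' = 0`. -/
def OneVariableTwistSolution {m : ℕ} (I : Fin m → Set ℝ) (A : Fin m → ℝ → ℝ) (j : Fin m)
    (a b : ℝ) (γ : Fin 3 → ℝ) : Prop :=
  (∃ F : ℝ → ℝ,
    IsDoubleIntegralOn F
      (fun x => (∑ r : Fin 3, γ r * x ^ (r : ℕ)) / (a + b * x) ^ (m + 3)) (I j) ∧
    ∀ x ∈ I j, A j x = (a + b * x) ^ (m + 1) * F x) ∧
  (∀ i, i ≠ j → IsPolynomialOn 2 (A i) (I i)) ∧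
  (∀ x : Fin m → ℝ, (∀ i, x i ∈ I i) →
    γ 2 + b ^ 2 * ∑ i ∈ Finset.univ.erase j, deriv (deriv (A i)) (x i) = 0)

end

/-! Write `f = ⟨μ, β⟩` and `b_k = ∂_k f`. Contraction identifies `𝔥` with the affine functions of
`x` (`segreMu_eq`, `eq_of_segreMu_eq`, `exists_segreMu_eq`), so `f` is affine and the components of
`μ_β` are quotients of affine functions by `f`.

Curvature. The metric is block diagonal in `(x, t)` and independent of `t`. Its scalar curvature
involves the fibre matrix `G` only through traces of `P_i = G⁻¹ ∂_i G` and of `P_i²`. Conjugation by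
`θ` makes `P_i` explicit, because the Hessian of a quotient of affine functions is known
(`hasPD_theta`). The outcome (`scalarCurvature_metric`, `scalarCurvature_eq_neg_div`) is that `-f`
times the scalar curvature equals `D = f² ∑ A_k'' - 2(m+1) f ∑ b_k A_k' + (m+1)(m+2) ∑ b_k² A_k`,
which is `extremalDefect`.

Killing potentials. The Hamiltonian field of a function of `x` is a combination of the `∂/∂t_r`, and
the Killing equation forces its coefficients to be constant. The potentials of such fields are the
affine functions divided by `f`. So the geometry is extremal if and only if `D` is affine in `x`
(`isExtremal_iff`).

Analysis. If `D` is affine, its second derivatives vanish, and the number of nonzero `b_k` decides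
what follows. If there is none, then `D = f² ∑ A_k''` and the `A_k` are cubic. If only `b_j ≠ 0`,
the other `A_i` are quadratic and the equation becomes a linear second order equation for `A_j`
whose left side is `f^{m+3} (A_j / f^{m+1})''`. If `b_i` and `b_j` are both nonzero, further
derivatives of `∂_i ∂_j D = 0` separate the variables and bound the degree of `A_i` by 4
(`iterate_five_eq_zero`). Combining them also produces a factor `m - 2`: for `m = 2` the quartics
survive with linear relations among their coefficients, while for `m ≥ 3` first `A_i'''` and then
`A_i''` vanish (`iterate_three_eq_zero_of_pair`, `iterate_two_eq_zero_of_pair`). The converses are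
substitutions into `D`. -/

set_option linter.unusedSectionVars false
set_option linter.unusedSimpArgs false
set_option linter.unusedVariables false

/-! ### Partial derivatives -/

namespace Chart

variable {ι κ : Type} [Fintype ι] [DecidableEq ι] [Fintype κ] [DecidableEq κ]

/-- `F` is differentiable at `p`, and its `i`-th partial derivative there is `F'`. -/
def HasPD (i : ι) (F : (ι → ℝ) → ℝ) (F' : ℝ) (p : ι → ℝ) : Prop :=
  DifferentiableAt ℝ F p ∧ pd i F p = F'

variable {i : ι} {F H : (ι → ℝ) → ℝ} {F' H' : ℝ} {p : ι → ℝ}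

theorem HasPD.differentiableAt (h : HasPD i F F' p) : DifferentiableAt ℝ F p := h.1

theorem _root_.DifferentiableAt.hasPD (h : DifferentiableAt ℝ F p) (i : ι) :
    HasPD i F (pd i F p) p := ⟨h, rfl⟩

theorem HasPD.of_eq (h : HasPD i F F' p) (e : F' = H') : HasPD i F H' p := e ▸ h

theorem HasPD.congr_of_eventuallyEq (h : HasPD i F F' p) (e : H =ᶠ[nhds p] F) :
    HasPD i H F' p :=
  ⟨h.1.congr_of_eventuallyEq e, by rw [pd, e.fderiv_eq]; exact h.2⟩

theorem pd_congr (e : H =ᶠ[nhds p] F) : pd i H p = pd i F p := by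
  rw [pd, e.fderiv_eq, pd]

theorem pd_congr_on {U : Set (ι → ℝ)} (hU : IsOpen U) (hp : p ∈ U) (e : ∀ q ∈ U, H q = F q) :
    pd i H p = pd i F p :=
  pd_congr (Filter.eventuallyEq_of_mem (hU.mem_nhds hp) e)

theorem HasPD.congr_on {U : Set (ι → ℝ)} (h : HasPD i F F' p) (hU : IsOpen U) (hp : p ∈ U)
    (e : ∀ q ∈ U, H q = F q) : HasPD i H F' p :=
  h.congr_of_eventuallyEq (Filter.eventuallyEq_of_mem (hU.mem_nhds hp) e)

/-- Two functions that agree on an open set have the same partial derivatives there. -/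
theorem HasPD.unique_on {U : Set (ι → ℝ)} (h : HasPD i F F' p) (k : HasPD i H H' p)
    (hU : IsOpen U) (hp : p ∈ U) (e : ∀ q ∈ U, F q = H q) : F' = H' := by
  rw [← h.2, ← k.2, pd_congr_on hU hp e]

theorem hasPD_const (i : ι) (c : ℝ) (p : ι → ℝ) : HasPD i (fun _ => c) 0 p :=
  ⟨differentiableAt_const c, by simp [pd]⟩

@[simp] theorem pd_const (i : ι) (c : ℝ) (p : ι → ℝ) : pd i (fun _ => c) p = 0 :=
  (hasPD_const i c p).2

theorem HasPD.add (h : HasPD i F F' p) (k : HasPD i H H' p) :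
    HasPD i (fun q => F q + H q) (F' + H') p :=
  ⟨h.1.add k.1, by rw [pd, fderiv_fun_add h.1 k.1]; simp [← h.2, ← k.2, pd]⟩

theorem HasPD.neg (h : HasPD i F F' p) : HasPD i (fun q => -F q) (-F') p :=
  ⟨h.1.neg, by rw [pd, fderiv_fun_neg]; simp [← h.2, pd]⟩

theorem HasPD.sub (h : HasPD i F F' p) (k : HasPD i H H' p) :
    HasPD i (fun q => F q - H q) (F' - H') p :=
  ⟨h.1.sub k.1, by rw [pd, fderiv_fun_sub h.1 k.1]; simp [← h.2, ← k.2, pd]⟩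

theorem HasPD.mul (h : HasPD i F F' p) (k : HasPD i H H' p) :
    HasPD i (fun q => F q * H q) (F' * H p + F p * H') p :=
  ⟨h.1.mul k.1, by rw [pd, fderiv_fun_mul h.1 k.1]; simp [← h.2, ← k.2, pd]; ring⟩

theorem HasPD.const_mul (c : ℝ) (h : HasPD i F F' p) : HasPD i (fun q => c * F q) (c * F') p :=
  ((hasPD_const i c p).mul h).of_eq (by ring)

theorem HasPD.inv (h : HasPD i F F' p) (h0 : F p ≠ 0) :
    HasPD i (fun q => (F q)⁻¹) (-F' / F p ^ 2) p :=
  ⟨h.1.inv h0, by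
    have := ((hasDerivAt_inv h0).comp_hasFDerivAt p h.1.hasFDerivAt).fderiv
    rw [pd, show (fun q => (F q)⁻¹) = Inv.inv ∘ F from rfl, this]
    simp [← h.2, pd]; ring⟩

theorem HasPD.div (h : HasPD i F F' p) (k : HasPD i H H' p) (h0 : H p ≠ 0) :
    HasPD i (fun q => F q / H q) ((F' * H p - F p * H') / H p ^ 2) p := by
  simp only [div_eq_mul_inv (F _)]
  exact (h.mul (k.inv h0)).of_eq (by field_simp; ring)

theorem HasPD.sum {α : Type} {s : Finset α} {F : α → (ι → ℝ) → ℝ} {F' : α → ℝ}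
    (h : ∀ a ∈ s, HasPD i (F a) (F' a) p) :
    HasPD i (fun q => ∑ a ∈ s, F a q) (∑ a ∈ s, F' a) p := by
  classical
  induction s using Finset.induction_on with
  | empty => simpa using hasPD_const i 0 p
  | insert a s ha ih =>
    simp only [Finset.sum_insert ha]
    exact (h a (by simp)).add (ih fun b hb => h b (by simp [hb]))

theorem hasPD_comp_apply {B : ℝ → ℝ} {B' : ℝ} (i k : ι) (h : HasDerivAt B B' (p k)) :
    HasPD i (fun q => B (q k)) (if k = i then B' else 0) p := by
  have h1 : HasFDerivAt (fun q : ι → ℝ => B (q k)) (B' • ContinuousLinearMap.proj (R := ℝ) (φ := fun _ : ι => ℝ) k) p :=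
    h.comp_hasFDerivAt p (ContinuousLinearMap.proj (R := ℝ) (φ := fun _ : ι => ℝ) k).hasFDerivAt
  refine ⟨h1.differentiableAt, ?_⟩
  rw [pd, h1.fderiv]
  simp [Pi.single_apply]

theorem hasPD_apply (i k : ι) : HasPD i (fun q => q k) (if k = i then 1 else 0) p :=
  hasPD_comp_apply (B := fun s => s) i k (hasDerivAt_id _)

/-- The linear projection to the first block of coordinates. -/
def fstBlock : (ι ⊕ κ → ℝ) →L[ℝ] (ι → ℝ) :=
  ContinuousLinearMap.pi fun j => ContinuousLinearMap.proj (Sum.inl j)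

@[simp] theorem fstBlock_apply (q : ι ⊕ κ → ℝ) (j : ι) : fstBlock q j = q (Sum.inl j) := rfl

/-- A function of the first block of coordinates has the same partial derivatives in these. -/
theorem HasPD.comp_fstBlock {q : ι ⊕ κ → ℝ} (h : HasPD i F F' (fstBlock q)) :
    HasPD (Sum.inl i) (fun r : ι ⊕ κ → ℝ => F (fstBlock r)) F' q := by
  have h1 := h.1.hasFDerivAt.comp q (fstBlock (ι := ι) (κ := κ)).hasFDerivAt
  refine ⟨h1.differentiableAt, ?_⟩
  have : fstBlock (Pi.single (Sum.inl i) 1 : ι ⊕ κ → ℝ) = Pi.single i 1 := by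
    ext j; simp [Pi.single_apply]
  rw [pd, show (fun r : ι ⊕ κ → ℝ => F (fstBlock r)) = F ∘ fstBlock from rfl, h1.fderiv]
  simp [this, ← h.2, pd]

/-- A function of the first block of coordinates is constant in the other ones. -/
theorem pd_inr_comp_fstBlock (F : (ι → ℝ) → ℝ) (r : κ) (q : ι ⊕ κ → ℝ) :
    pd (Sum.inr r) (fun q : ι ⊕ κ → ℝ => F (fstBlock q)) q = 0 := by
  by_cases hd : DifferentiableAt ℝ (fun q : ι ⊕ κ → ℝ => F (fstBlock q)) q
  · rw [pd, ← hd.lineDeriv_eq_fderiv, lineDeriv]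
    have : ∀ s : ℝ, fstBlock (q + s • Pi.single (Sum.inr r) (1 : ℝ)) = fstBlock q := by
      intro s; ext j; simp
    simp [this]
  · rw [pd, fderiv_zero_of_not_differentiableAt hd]; rfl

/-- Partial derivatives of functions of the first block of coordinates are again such. -/
theorem pd_comp_fstBlock (F : (ι → ℝ) → ℝ) (a : ι ⊕ κ) :
    ∃ F' : (ι → ℝ) → ℝ, ∀ q,
      pd a (fun q : ι ⊕ κ → ℝ => F (fstBlock q)) q = F' (fstBlock q) := by
  refine ⟨fun x => pd a (fun q : ι ⊕ κ → ℝ => F (fstBlock q)) (Sum.elim x 0), fun q => ?_⟩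
  have h : ∀ v, (fun q : ι ⊕ κ → ℝ => F (fstBlock q)) (v + (Sum.elim (fstBlock q) 0 - q))
      = F (fstBlock v) := by
    intro v
    simp only
    congr 1
    ext j; simp
  have := fderiv_comp_add_right (𝕜 := ℝ) (f := (fun q : ι ⊕ κ → ℝ => F (fstBlock q)))
    (x := q) (Sum.elim (fstBlock q) 0 - q)
  simp only [h] at this
  simp only [pd]
  rw [this]
  simp

end Chart

/-! ### The momentum map of the product Segre factorization structure -/

section Segre

open Chart

variable {m : ℕ}

theorem segreContract_tprod (x : Fin m → ℝ) :
    segreContract x (PiTensorProduct.tprod ℝ fun _ => ![1, 0]) = 1 := by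
  simp [segreContract]

theorem segreContract_segreIns (x : Fin m → ℝ) (j : Fin m) (w : Fin 2 → ℝ) :
    segreContract x (segreIns j w) = w 0 + x j * w 1 := by
  simp only [segreContract, segreIns, MultilinearMap.toLinearMap_apply,
    PiTensorProduct.lift.tprod, MultilinearMap.compLinearMap_apply,
    MultilinearMap.mkPiAlgebra_apply]
  rw [Fintype.prod_eq_single j]
  · simp
  · intro i hi; simp [hi]

theorem segreIns_eq (j : Fin m) (w : Fin 2 → ℝ) :
    segreIns j w = w 0 • PiTensorProduct.tprod ℝ (fun _ => ![1, 0]) + w 1 • segreIns j ![0, 1] := by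
  have h1 : segreIns j ![1, 0] = PiTensorProduct.tprod ℝ (fun _ : Fin m => (![1, 0] : Fin 2 → ℝ)) := by
    simp [segreIns]
  have h2 : w = w 0 • ![1, 0] + w 1 • ![0, 1] := by
    ext i; fin_cases i <;> simp
  conv_lhs => rw [h2]
  rw [map_add, map_smul, map_smul, h1]

theorem segreIns_mem (j : Fin m) (w : Fin 2 → ℝ) : segreIns j w ∈ productSegre m :=
  Submodule.mem_iSup_of_mem j ⟨w, rfl⟩

theorem tprod_mem_productSegre (hm : 0 < m) :
    (PiTensorProduct.tprod ℝ fun _ => ![1, 0]) ∈ productSegre m := by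
  simpa [segreIns] using segreIns_mem (m := m) ⟨0, hm⟩ ![1, 0]

theorem exists_eq_of_mem_productSegre {z : SegreTensor m} (hz : z ∈ productSegre m) :
    ∃ (c : ℝ) (b : Fin m → ℝ), z = c • PiTensorProduct.tprod ℝ (fun _ => ![1, 0]) +
      ∑ k, b k • segreIns k ![0, 1] := by
  induction hz using Submodule.iSup_induction' with
  | mem j z hz =>
    obtain ⟨w, rfl⟩ := hz
    refine ⟨w 0, Pi.single j (w 1), ?_⟩
    rw [segreIns_eq]
    simp [Pi.single_apply, ite_smul]
  | zero => exact ⟨0, 0, by simp⟩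
  | add y z _ _ hy hz =>
    obtain ⟨c, b, rfl⟩ := hy
    obtain ⟨c', b', rfl⟩ := hz
    exact ⟨c + c', b + b', by simp [add_smul, Finset.sum_add_distrib]; abel⟩

/-- The coefficient of `x_j` in the affine function `x ↦ ⟨μ(x), η⟩`. -/
def segreSlope (η : productSegre m) (j : Fin m) : ℝ :=
  segreMu (Pi.single j 1) η - segreMu 0 η

theorem segreContract_affine (x : Fin m → ℝ) (c : ℝ) (b : Fin m → ℝ) :
    segreContract x (c • PiTensorProduct.tprod ℝ (fun _ => ![1, 0]) +
      ∑ k, b k • segreIns k ![0, 1]) = c + ∑ k, b k * x k := by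
  simp [segreContract_tprod, segreContract_segreIns]

theorem segreMu_eq (x : Fin m → ℝ) (η : productSegre m) :
    segreMu x η = segreMu 0 η + ∑ k, segreSlope η k * x k := by
  obtain ⟨c, b, h⟩ := exists_eq_of_mem_productSegre η.2
  have h1 : ∀ y : Fin m → ℝ, segreMu y η = c + ∑ k, b k * y k := fun y => by
    rw [← segreContract_affine, ← h]; rfl
  simp [segreSlope, h1, Pi.single_apply]

/-- An affine function determines its coefficients by its values at the origin and at the unit
vectors. With `exists_segreMu_eq` this lets all later arguments replace tensors in `𝔥` by affine
functions. -/
theorem eq_of_segreMu_eq {η η' : productSegre m} (h : ∀ x, segreMu x η = segreMu x η') :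
    η = η' := by
  obtain ⟨c, b, hz⟩ := exists_eq_of_mem_productSegre η.2
  obtain ⟨c', b', hz'⟩ := exists_eq_of_mem_productSegre η'.2
  have h1 : ∀ y : Fin m → ℝ, c + ∑ k, b k * y k = c' + ∑ k, b' k * y k := fun y => by
    rw [← segreContract_affine, ← segreContract_affine, ← hz, ← hz']
    exact h y
  have hc : c = c' := by simpa using h1 0
  have hb : b = b' := by
    ext k; simpa [hc, Pi.single_apply] using h1 (Pi.single k 1)
  ext1
  rw [hz, hz', hc, hb]

theorem exists_segreMu_eq (hm : 0 < m) (c : ℝ) (b : Fin m → ℝ) :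
    ∃ η : productSegre m, ∀ x, segreMu x η = c + ∑ k, b k * x k :=
  ⟨⟨c • PiTensorProduct.tprod ℝ (fun _ => ![1, 0]) + ∑ k, b k • segreIns k ![0, 1],
    add_mem (Submodule.smul_mem _ _ (tprod_mem_productSegre hm))
      (sum_mem fun k _ => Submodule.smul_mem _ _ (segreIns_mem k _))⟩,
    fun x => segreContract_affine x c b⟩

theorem coe_eq_smul_tprod_iff (hm : 0 < m) (η : productSegre m) (t : ℝ) :
    (η : SegreTensor m) = t • PiTensorProduct.tprod ℝ (fun _ => ![1, 0]) ↔
      ∀ x : Fin m → ℝ, segreMu x η = t := by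
  have h0 : ∀ x, segreContract x (t • PiTensorProduct.tprod ℝ (fun _ : Fin m => (![1, 0] : Fin 2 → ℝ))) = t := by
    simp [segreContract_tprod]
  refine ⟨fun h x => ?_, fun h => ?_⟩
  · rw [← h0 x, ← h]; rfl
  · have := eq_of_segreMu_eq (η := η)
      (η' := ⟨_, Submodule.smul_mem _ t (tprod_mem_productSegre hm)⟩)
      fun x => (h x).trans (h0 x).symm
    exact congrArg Subtype.val this

theorem coe_eq_sum_segreIns_iff (η : productSegre m) (S : Finset (Fin m)) (a b : Fin m → ℝ) :
    (η : SegreTensor m) = ∑ j ∈ S, segreIns j ![a j, b j] ↔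
      ∀ x : Fin m → ℝ, segreMu x η = (∑ j ∈ S, a j) + ∑ j ∈ S, b j * x j := by
  have h0 : ∀ x, segreContract x (∑ j ∈ S, segreIns j ![a j, b j]) =
      (∑ j ∈ S, a j) + ∑ j ∈ S, b j * x j := fun x => by
    simp [segreContract_segreIns, Finset.sum_add_distrib, mul_comm]
  refine ⟨fun h x => ?_, fun h => ?_⟩
  · rw [← h0 x, ← h]; rfl
  · have := eq_of_segreMu_eq (η := η)
      (η' := ⟨_, sum_mem fun j _ => segreIns_mem j ![a j, b j]⟩)
      fun x => (h x).trans (h0 x).symm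
    exact congrArg Subtype.val this

theorem hasPD_segreMu (η : productSegre m) (j : Fin m) (x : Fin m → ℝ) :
    HasPD j (fun y => segreMu y η) (segreSlope η j) x := by
  have h : HasPD j (fun y : Fin m → ℝ => segreMu 0 η + ∑ k, segreSlope η k * y k)
      (0 + ∑ k, segreSlope η k * if k = j then 1 else 0) x :=
    (hasPD_const _ _ _).add (HasPD.sum fun k _ => (hasPD_apply j k).const_mul _)
  rw [funext fun y => segreMu_eq y η]
  exact h.of_eq (by simp)

end Segre

/-! ### Block metrics `∑ h_j dx_j² + ∑ G_{rs} dt_r dt_s` that depend only on `x` -/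

/-- The rearrangement that contracts the `t`-block of the Ricci tensor with `G⁻¹` (the weights `w`),
one base direction `k` at a time. -/
theorem sum_mul_sum_add {κ τ : Type} [Fintype κ] [Fintype τ] (w : τ → τ → ℝ) (c d : κ → ℝ) (X Y : κ → τ → τ → ℝ) :
    ∑ r, ∑ s, w r s * (-(1 / 2) * ∑ k, (c k * X k r s + d k * Y k r s)) =
      -(1 / 2 * ∑ k, (c k * ∑ r, ∑ s, w r s * X k r s + d k * ∑ r, ∑ s, w r s * Y k r s)) := by
  have h1 : ∀ k, c k * ∑ r, ∑ s, w r s * X k r s + d k * ∑ r, ∑ s, w r s * Y k r s =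
      ∑ r, ∑ s, w r s * (c k * X k r s + d k * Y k r s) := fun k => by
    simp only [Finset.mul_sum, ← Finset.sum_add_distrib]
    exact Finset.sum_congr rfl fun r _ => Finset.sum_congr rfl fun s _ => by ring
  have h2 : ∀ r, ∑ k, ∑ s, w r s * (c k * X k r s + d k * Y k r s) =
      ∑ s, w r s * ∑ k, (c k * X k r s + d k * Y k r s) := fun r => by
    rw [Finset.sum_comm]; simp only [Finset.mul_sum]
  rw [Finset.sum_congr rfl fun k _ => h1 k,
    Finset.sum_comm (s := (Finset.univ : Finset κ)), Finset.sum_congr rfl fun r _ => h2 r,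
    ← neg_mul, Finset.mul_sum]
  simp only [Finset.mul_sum (s := (Finset.univ : Finset τ))]
  exact Finset.sum_congr rfl fun r _ => Finset.sum_congr rfl fun s _ => by ring

namespace Chart

variable {κ τ : Type} [Fintype κ] [DecidableEq κ] [Fintype τ] [DecidableEq τ]

/-- The metric `∑_j h_j(x) dx_j² + ∑_{r,s} G_{rs}(x) dt_r dt_s` in the coordinates `(x, t)`. -/
def blockMetric (h : κ → (κ → ℝ) → ℝ) (G : (κ → ℝ) → Matrix τ τ ℝ) (p : κ ⊕ τ → ℝ) :
    Matrix (κ ⊕ τ) (κ ⊕ τ) ℝ :=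
  Matrix.fromBlocks (Matrix.diagonal fun j => h j (fstBlock p)) 0 0 (G (fstBlock p))

/-- Translations in `t` preserve the metric components, hence everything built from them. No
regularity is needed: the default value of `fderiv` is translation invariant too. -/
theorem christoffel_blockMetric_eq_comp (h : κ → (κ → ℝ) → ℝ) (G : (κ → ℝ) → Matrix τ τ ℝ)
    (a b c : κ ⊕ τ) : ∃ F : (κ → ℝ) → ℝ, ∀ p,
      christoffel (blockMetric h G) a b c p = F (fstBlock p) := by
  choose F hF using fun a b c : κ ⊕ τ => pd_comp_fstBlock (κ := τ)
    (fun x => Matrix.fromBlocks (Matrix.diagonal fun j => h j x) 0 0 (G x) b c) a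
  refine ⟨fun x => (1 / 2) * ∑ d, (Matrix.fromBlocks (Matrix.diagonal fun j => h j x) 0 0 (G x))⁻¹
    a d * (F b d c x + F c d b x - F d b c x), fun p => ?_⟩
  simp only [← hF]
  rfl

theorem scalarCurvature_blockMetric_eq_comp (h : κ → (κ → ℝ) → ℝ) (G : (κ → ℝ) → Matrix τ τ ℝ) :
    ∃ F : (κ → ℝ) → ℝ, ∀ p, scalarCurvature (blockMetric h G) p = F (fstBlock p) := by
  choose Γ hΓ using christoffel_blockMetric_eq_comp h G
  have hΓ' : ∀ a b c, christoffel (blockMetric h G) a b c = fun p => Γ a b c (fstBlock p) :=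
    fun a b c => funext (hΓ a b c)
  choose F hF using fun a b c d : κ ⊕ τ => pd_comp_fstBlock (κ := τ) (Γ b c d) a
  refine ⟨fun x => ∑ b, ∑ c, (Matrix.fromBlocks (Matrix.diagonal fun j => h j x) 0 0 (G x))⁻¹ b c *
    ((∑ a, (F a a b c x - F b a a c x)) +
      ∑ a, ∑ d, (Γ a a d x * Γ d b c x - Γ a b d x * Γ d a c x)), fun p => ?_⟩
  simp only [scalarCurvature, ricci, hΓ', hF]
  rfl

/-- The data of a block metric: the derivatives `h' b a = ∂_b h_a`, the matrices
`P_i = G⁻¹ ∂_i G` and the Christoffel symbols `L` of `∑_j h_j dx_j²`. -/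
structure IsBlockMetric (U : Set (κ → ℝ)) (h : κ → (κ → ℝ) → ℝ) (G : (κ → ℝ) → Matrix τ τ ℝ)
    (h' : κ → κ → (κ → ℝ) → ℝ) (P : κ → (κ → ℝ) → Matrix τ τ ℝ)
    (L : κ → κ → κ → (κ → ℝ) → ℝ) : Prop where
  isOpen : IsOpen U
  ne_zero : ∀ x ∈ U, ∀ j, h j x ≠ 0
  isUnit_det : ∀ x ∈ U, IsUnit (G x).det
  symm : ∀ x ∈ U, (G x).transpose = G x
  hasPD_diag : ∀ x ∈ U, ∀ i j, HasPD i (h j) (h' i j x) x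
  hasPD_block : ∀ x ∈ U, ∀ i r s, HasPD i (fun y => G y r s) ((G x * P i x) r s) x
  differentiableAt_P : ∀ x ∈ U, ∀ i r s, DifferentiableAt ℝ (fun y => P i y r s) x
  differentiableAt_L : ∀ x ∈ U, ∀ a b c, DifferentiableAt ℝ (L a b c) x
  L_eq : ∀ x ∈ U, ∀ a b c, L a b c x = (1 / 2) * ((h a x)⁻¹ *
    ((if a = c then h' b a x else 0) + (if a = b then h' c a x else 0)
      - (if b = c then h' a b x else 0)))

namespace IsBlockMetric

variable {U : Set (κ → ℝ)} {h : κ → (κ → ℝ) → ℝ} {G : (κ → ℝ) → Matrix τ τ ℝ}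
  {h' : κ → κ → (κ → ℝ) → ℝ} {P : κ → (κ → ℝ) → Matrix τ τ ℝ} {L : κ → κ → κ → (κ → ℝ) → ℝ}
  {p : κ ⊕ τ → ℝ}

theorem inv_eq (B : IsBlockMetric U h G h' P L) (hp : fstBlock p ∈ U) :
    (blockMetric h G p)⁻¹ = Matrix.fromBlocks
      (Matrix.diagonal fun j => (h j (fstBlock p))⁻¹) 0 0 (G (fstBlock p))⁻¹ := by
  apply Matrix.inv_eq_right_inv
  rw [blockMetric, Matrix.fromBlocks_multiply]
  simp only [Matrix.zero_mul, Matrix.mul_zero, add_zero, zero_add,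
    Matrix.mul_nonsing_inv _ (B.isUnit_det _ hp), Matrix.diagonal_mul_diagonal]
  simp only [mul_inv_cancel₀ (B.ne_zero _ hp _), Matrix.diagonal_one, Matrix.fromBlocks_one]

theorem pd_inr (d e : κ ⊕ τ) (r : τ) : pd (Sum.inr r) (fun q => blockMetric h G q d e) p = 0 :=
  pd_inr_comp_fstBlock
    (fun x => Matrix.fromBlocks (Matrix.diagonal fun j => h j x) 0 0 (G x) d e) r p

theorem pd_inl_inl (B : IsBlockMetric U h G h' P L) (hp : fstBlock p ∈ U) (i j k : κ) :
    pd (Sum.inl i) (fun q => blockMetric h G q (Sum.inl j) (Sum.inl k)) p =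
      if j = k then h' i j (fstBlock p) else 0 := by
  simp only [blockMetric, Matrix.fromBlocks_apply₁₁, Matrix.diagonal_apply]
  split_ifs
  · exact (B.hasPD_diag _ hp i j).comp_fstBlock.2
  · simp

theorem pd_inl_inr (B : IsBlockMetric U h G h' P L) (hp : fstBlock p ∈ U) (i : κ) (r s : τ) :
    pd (Sum.inl i) (fun q => blockMetric h G q (Sum.inr r) (Sum.inr s)) p =
      (G (fstBlock p) * P i (fstBlock p)) r s :=
  (B.hasPD_block _ hp i r s).comp_fstBlock.2

theorem pd_mixed (d : κ ⊕ τ) (i : κ) (r : τ) :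
    pd d (fun q => blockMetric h G q (Sum.inl i) (Sum.inr r)) p = 0 := by
  simp [blockMetric]

theorem pd_mixed' (d : κ ⊕ τ) (i : κ) (r : τ) :
    pd d (fun q => blockMetric h G q (Sum.inr r) (Sum.inl i)) p = 0 := by
  simp [blockMetric]

theorem christoffel_inl_inl_inl (B : IsBlockMetric U h G h' P L) (hp : fstBlock p ∈ U)
    (a b c : κ) : christoffel (blockMetric h G) (.inl a) (.inl b) (.inl c) p =
      L a b c (fstBlock p) := by
  rw [B.L_eq _ hp, christoffel, B.inv_eq hp]
  simp only [Fintype.sum_sum_type, Matrix.fromBlocks_apply₁₁, Matrix.fromBlocks_apply₁₂,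
    Matrix.zero_apply, zero_mul, Finset.sum_const_zero, add_zero, B.pd_inl_inl hp,
    Matrix.diagonal_apply, ite_mul, Finset.sum_ite_eq, Finset.mem_univ, if_true]

theorem christoffel_inl_inl_inr (B : IsBlockMetric U h G h' P L) (hp : fstBlock p ∈ U)
    (a b : κ) (r : τ) : christoffel (blockMetric h G) (.inl a) (.inl b) (.inr r) p = 0 := by
  rw [christoffel, B.inv_eq hp]
  simp [Fintype.sum_sum_type, pd_inr, pd_mixed]

theorem christoffel_inl_inr_inl (B : IsBlockMetric U h G h' P L) (hp : fstBlock p ∈ U)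
    (a b : κ) (r : τ) : christoffel (blockMetric h G) (.inl a) (.inr r) (.inl b) p = 0 := by
  rw [christoffel, B.inv_eq hp]
  simp [Fintype.sum_sum_type, pd_inr, pd_mixed, pd_mixed']

theorem christoffel_inl_inr_inr (B : IsBlockMetric U h G h' P L) (hp : fstBlock p ∈ U)
    (a : κ) (r s : τ) : christoffel (blockMetric h G) (.inl a) (.inr r) (.inr s) p =
      -(1 / 2) * ((h a (fstBlock p))⁻¹ * (G (fstBlock p) * P a (fstBlock p)) r s) := by
  rw [christoffel, B.inv_eq hp]
  simp [Fintype.sum_sum_type, pd_inr, pd_mixed, B.pd_inl_inr hp, Matrix.diagonal_apply]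

theorem christoffel_inr_inl_inl (B : IsBlockMetric U h G h' P L) (hp : fstBlock p ∈ U)
    (r : τ) (a b : κ) : christoffel (blockMetric h G) (.inr r) (.inl a) (.inl b) p = 0 := by
  rw [christoffel, B.inv_eq hp]
  simp [Fintype.sum_sum_type, pd_inr, pd_mixed']

theorem sum_inv_mul (B : IsBlockMetric U h G h' P L) {x : κ → ℝ} (hx : x ∈ U) (i : κ) (r s : τ) :
    ∑ u, (G x)⁻¹ r u * (G x * P i x) u s = P i x r s := by
  rw [← Matrix.mul_apply, ← Matrix.mul_assoc, Matrix.nonsing_inv_mul _ (B.isUnit_det _ hx),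
    Matrix.one_mul]

theorem christoffel_inr_inl_inr (B : IsBlockMetric U h G h' P L) (hp : fstBlock p ∈ U)
    (r s : τ) (a : κ) : christoffel (blockMetric h G) (.inr r) (.inl a) (.inr s) p =
      (1 / 2) * P a (fstBlock p) r s := by
  rw [christoffel, B.inv_eq hp]
  simp [Fintype.sum_sum_type, pd_inr, pd_mixed, B.pd_inl_inr hp, B.sum_inv_mul hp]

theorem christoffel_inr_inr_inl (B : IsBlockMetric U h G h' P L) (hp : fstBlock p ∈ U)
    (r s : τ) (a : κ) : christoffel (blockMetric h G) (.inr r) (.inr s) (.inl a) p =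
      (1 / 2) * P a (fstBlock p) r s := by
  rw [christoffel, B.inv_eq hp]
  simp [Fintype.sum_sum_type, pd_inr, pd_mixed', B.pd_inl_inr hp, B.sum_inv_mul hp]

theorem christoffel_inr_inr_inr (B : IsBlockMetric U h G h' P L) (hp : fstBlock p ∈ U)
    (r s u : τ) : christoffel (blockMetric h G) (.inr r) (.inr s) (.inr u) p = 0 := by
  rw [christoffel, B.inv_eq hp]
  simp [Fintype.sum_sum_type, pd_inr]

theorem pd_inr_christoffel (a b c : κ ⊕ τ) (r : τ) :
    pd (Sum.inr r) (christoffel (blockMetric h G) a b c) p = 0 := by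
  obtain ⟨F, hF⟩ := christoffel_blockMetric_eq_comp h G a b c
  rw [show christoffel (blockMetric h G) a b c = _ from funext hF]
  exact pd_inr_comp_fstBlock F r p

theorem isOpen_preimage (B : IsBlockMetric U h G h' P L) :
    IsOpen {q : κ ⊕ τ → ℝ | fstBlock q ∈ U} :=
  B.isOpen.preimage fstBlock.continuous

theorem hasPD_inl_christoffel (B : IsBlockMetric U h G h' P L) (hp : fstBlock p ∈ U)
    {a b c : κ ⊕ τ} {F : (κ → ℝ) → ℝ} {F' : ℝ} {i : κ} (hF : HasPD i F F' (fstBlock p))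
    (e : ∀ q : κ ⊕ τ → ℝ, fstBlock q ∈ U → christoffel (blockMetric h G) a b c q = F (fstBlock q)) :
    pd (Sum.inl i) (christoffel (blockMetric h G) a b c) p = F' :=
  (hF.comp_fstBlock.congr_on B.isOpen_preimage hp e).2

theorem pd_christoffel_inl_inl_inl (B : IsBlockMetric U h G h' P L) (hp : fstBlock p ∈ U)
    (i a b c : κ) :
    pd (Sum.inl i) (christoffel (blockMetric h G) (.inl a) (.inl b) (.inl c)) p =
      pd i (L a b c) (fstBlock p) :=
  B.hasPD_inl_christoffel hp ((B.differentiableAt_L _ hp a b c).hasPD i)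
    fun _ hq => B.christoffel_inl_inl_inl hq a b c

theorem pd_christoffel_inr_inr_inl (B : IsBlockMetric U h G h' P L) (hp : fstBlock p ∈ U)
    (i a : κ) (r s : τ) :
    pd (Sum.inl i) (christoffel (blockMetric h G) (.inr r) (.inr s) (.inl a)) p =
      (1 / 2) * pd i (fun y => P a y r s) (fstBlock p) :=
  B.hasPD_inl_christoffel hp (((B.differentiableAt_P _ hp a r s).hasPD i).const_mul _)
    fun _ hq => B.christoffel_inr_inr_inl hq r s a

theorem hasPD_trace (B : IsBlockMetric U h G h' P L) {x : κ → ℝ} (hx : x ∈ U) (i a : κ) :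
    HasPD i (fun y => (P a y).trace) (∑ r, pd i (fun y => P a y r r) x) x :=
  HasPD.sum fun r _ => (B.differentiableAt_P _ hx a r r).hasPD i

theorem hasPD_block_mul (B : IsBlockMetric U h G h' P L) {x : κ → ℝ} (hx : x ∈ U) (i a : κ)
    (r s : τ) : HasPD i (fun y => (G y * P a y) r s)
      ((G x * P i x * P a x) r s + ∑ u, G x r u * pd i (fun y => P a y u s) x) x := by
  simp only [Matrix.mul_apply (M := G _) (N := P a _)]
  refine (HasPD.sum fun u _ => (B.hasPD_block x hx i r u).mul
    ((B.differentiableAt_P x hx a u s).hasPD i)).of_eq ?_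
  rw [Finset.sum_add_distrib, Matrix.mul_apply]

theorem pd_christoffel_inl_inr_inr (B : IsBlockMetric U h G h' P L) (hp : fstBlock p ∈ U)
    (i a : κ) (r s : τ) :
    pd (Sum.inl i) (christoffel (blockMetric h G) (.inl a) (.inr r) (.inr s)) p =
      -(1 / 2) * (pd i (fun y => (h a y)⁻¹) (fstBlock p) * (G (fstBlock p) * P a (fstBlock p)) r s +
        (h a (fstBlock p))⁻¹ * ((G (fstBlock p) * P i (fstBlock p) * P a (fstBlock p)) r s +
          ∑ u, G (fstBlock p) r u * pd i (fun y => P a y u s) (fstBlock p))) :=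
  B.hasPD_inl_christoffel hp
    (((((B.hasPD_diag _ hp i a).inv (B.ne_zero _ hp a)).1.hasPD i).mul
      (B.hasPD_block_mul hp i a r s)).const_mul _)
    fun _ hq => B.christoffel_inl_inr_inr hq a r s

/-- Since `g⁻¹` is diagonal on the `x`-block, no other components of that block enter the scalar
curvature. The fibre contributes through `Γʳ_{is} = P_i / 2`, that is, through traces of `P_i` and
`P_i²`. -/
theorem ricci_inl_inl (B : IsBlockMetric U h G h' P L) (hp : fstBlock p ∈ U) (i : κ) :
    ricci (blockMetric h G) (.inl i) (.inl i) p =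
      ∑ a, pd a (L a i i) (fstBlock p) - ∑ a, pd i (L a a i) (fstBlock p)
        - (1 / 2) * pd i (fun y => (P i y).trace) (fstBlock p)
        + ∑ k, (∑ a, L a a k (fstBlock p) + (1 / 2) * (P k (fstBlock p)).trace) *
            L k i i (fstBlock p)
        - ∑ a, ∑ k, L a i k (fstBlock p) * L k a i (fstBlock p)
        - (1 / 4) * (P i (fstBlock p) * P i (fstBlock p)).trace := by
  rw [ricci, (B.hasPD_trace hp i i).2]
  simp only [Fintype.sum_sum_type, B.pd_christoffel_inl_inl_inl hp,
    B.pd_christoffel_inr_inr_inl hp, pd_inr_christoffel, B.christoffel_inl_inl_inl hp,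
    B.christoffel_inl_inl_inr hp, B.christoffel_inl_inr_inl hp, B.christoffel_inr_inl_inl hp,
    B.christoffel_inr_inl_inr hp, B.christoffel_inr_inr_inl hp, B.christoffel_inr_inr_inr hp,
    mul_zero, zero_mul, sub_zero, zero_sub, Finset.sum_const_zero, add_zero, zero_add,
    Matrix.trace, Matrix.diag, Matrix.mul_apply, Finset.sum_sub_distrib, Finset.sum_neg_distrib,
    Finset.sum_add_distrib, add_mul, Finset.sum_mul, Finset.mul_sum]
  rw [Finset.sum_comm (f := fun a k => L a a k (fstBlock p) * L k i i (fstBlock p)),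
    Finset.sum_comm (f := fun (r : τ) k => 1 / 2 * P k (fstBlock p) r r * L k i i (fstBlock p))]
  have : ∀ r s, 1 / 2 * P i (fstBlock p) r s * (1 / 2 * P i (fstBlock p) s r) =
    1 / 4 * (P i (fstBlock p) r s * P i (fstBlock p) s r) := fun r s => by ring
  simp only [this]
  ring

theorem block_mul_symm (B : IsBlockMetric U h G h' P L) {x : κ → ℝ} (hx : x ∈ U) (k : κ) (r s : τ) :
    (G x * P k x) r s = (G x * P k x) s r :=
  (B.hasPD_block x hx k r s).unique_on (B.hasPD_block x hx k s r) B.isOpen hx fun y hy => by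
    conv_lhs => rw [← B.symm y hy, Matrix.transpose_apply]

theorem sum_mul_block_mul (B : IsBlockMetric U h G h' P L) {x : κ → ℝ} (hx : x ∈ U) (k : κ)
    (r s : τ) : ∑ u, P k x u r * (G x * P k x) u s = (G x * P k x * P k x) r s := by
  have h1 : (G x * P k x).transpose = G x * P k x := by
    ext a b; exact B.block_mul_symm hx k b a
  have h2 : (P k x).transpose * (G x * P k x) = G x * P k x * P k x := by
    rw [← Matrix.mul_assoc]
    congr 1
    conv_rhs => rw [← h1, Matrix.transpose_mul, B.symm x hx]
  rw [← h2]; rfl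

/-- The terms `h_k⁻¹ G P_k P_k` cancel: the derivative of `Γᵏ_{rs}` contributes `-1/2` and each of
the two mixed products of Christoffel symbols `+1/4`. Recognising the second product requires the
symmetry of `G P_k`. -/
theorem ricci_inr_inr (B : IsBlockMetric U h G h' P L) (hp : fstBlock p ∈ U) (r s : τ) :
    ricci (blockMetric h G) (.inr r) (.inr s) p =
      -(1 / 2) * ∑ k, ((pd k (fun y => (h k y)⁻¹) (fstBlock p) +
          (∑ a, L a a k (fstBlock p) + (1 / 2) * (P k (fstBlock p)).trace) *
            (h k (fstBlock p))⁻¹) * (G (fstBlock p) * P k (fstBlock p)) r s +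
        (h k (fstBlock p))⁻¹ *
          ∑ u, G (fstBlock p) r u * pd k (fun y => P k y u s) (fstBlock p)) := by
  rw [ricci]
  simp only [Fintype.sum_sum_type, B.pd_christoffel_inl_inr_inr hp, pd_inr_christoffel,
    B.christoffel_inl_inl_inl hp, B.christoffel_inl_inr_inr hp,
    B.christoffel_inl_inl_inr hp, B.christoffel_inl_inr_inl hp,
    B.christoffel_inr_inl_inr hp, B.christoffel_inr_inr_inl hp, B.christoffel_inr_inr_inr hp,
    mul_zero, zero_mul, sub_zero, zero_sub, Finset.sum_const_zero, add_zero, zero_add,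
    Finset.sum_sub_distrib, Finset.sum_neg_distrib, Finset.sum_add_distrib]
  set x := fstBlock p
  have e1 : ∀ k, ∑ u, -(1 / 2) * ((h k x)⁻¹ * (G x * P k x) r u) * (1 / 2 * P k x u s) =
      -(1 / 4) * ((h k x)⁻¹ * (G x * P k x * P k x) r s) := fun k => by
    rw [Matrix.mul_apply (M := G x * P k x), Finset.mul_sum, Finset.mul_sum]
    exact Finset.sum_congr rfl fun u _ => by ring
  have e2 : ∑ u, ∑ k, 1 / 2 * P k x u r * (-(1 / 2) * ((h k x)⁻¹ * (G x * P k x) u s)) =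
      ∑ k, -(1 / 4) * ((h k x)⁻¹ * (G x * P k x * P k x) r s) := by
    rw [Finset.sum_comm]
    refine Finset.sum_congr rfl fun k _ => ?_
    rw [← B.sum_mul_block_mul hp k r s, Finset.mul_sum, Finset.mul_sum]
    exact Finset.sum_congr rfl fun u _ => by ring
  rw [e2, Finset.sum_congr rfl fun k _ => e1 k,
    Finset.sum_comm (f := fun a k => L a a k x * _),
    Finset.sum_comm (f := fun (u : τ) k => 1 / 2 * P k x u u * _)]
  simp only [← Finset.sum_add_distrib, ← Finset.sum_sub_distrib, Finset.mul_sum (a := -(1 / 2 : ℝ))]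
  refine Finset.sum_congr rfl fun k _ => ?_
  rw [← Finset.sum_mul, ← Finset.sum_mul, ← Finset.mul_sum, Matrix.trace]
  simp only [Matrix.diag]
  ring

theorem trace_inv_mul (B : IsBlockMetric U h G h' P L) {x : κ → ℝ} (hx : x ∈ U) (Q : Matrix τ τ ℝ) :
    ∑ r, ∑ s, (G x)⁻¹ r s * (G x * Q) r s = Q.trace := by
  have h1 : ((G x)⁻¹).transpose = (G x)⁻¹ := by
    rw [Matrix.transpose_nonsing_inv, B.symm x hx]
  calc _ = (((G x)⁻¹).transpose * (G x * Q)).trace := by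
        rw [Finset.sum_comm]; rfl
    _ = _ := by
        rw [h1, ← Matrix.mul_assoc, Matrix.nonsing_inv_mul _ (B.isUnit_det x hx), Matrix.one_mul]

/-- The scalar curvature of a block metric. -/
theorem scalarCurvature_eq (B : IsBlockMetric U h G h' P L) (hp : fstBlock p ∈ U) :
    scalarCurvature (blockMetric h G) p =
      ∑ i, (h i (fstBlock p))⁻¹ * (∑ a, pd a (L a i i) (fstBlock p)
        - ∑ a, pd i (L a a i) (fstBlock p)
        - (1 / 2) * pd i (fun y => (P i y).trace) (fstBlock p)
        + ∑ k, (∑ a, L a a k (fstBlock p) + (1 / 2) * (P k (fstBlock p)).trace) *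
            L k i i (fstBlock p)
        - ∑ a, ∑ k, L a i k (fstBlock p) * L k a i (fstBlock p)
        - (1 / 4) * (P i (fstBlock p) * P i (fstBlock p)).trace)
      - (1 / 2) * ∑ k, ((pd k (fun y => (h k y)⁻¹) (fstBlock p) +
          (∑ a, L a a k (fstBlock p) + (1 / 2) * (P k (fstBlock p)).trace) *
            (h k (fstBlock p))⁻¹) * (P k (fstBlock p)).trace +
        (h k (fstBlock p))⁻¹ * pd k (fun y => (P k y).trace) (fstBlock p)) := by
  rw [scalarCurvature, B.inv_eq hp]
  simp only [Fintype.sum_sum_type, Matrix.fromBlocks_apply₁₁, Matrix.fromBlocks_apply₁₂,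
    Matrix.fromBlocks_apply₂₁, Matrix.fromBlocks_apply₂₂, Matrix.zero_apply, zero_mul,
    Finset.sum_const_zero, add_zero, zero_add, Matrix.diagonal_apply, ite_mul,
    Finset.sum_ite_eq, Finset.mem_univ, if_true, B.ricci_inl_inl hp]
  rw [sub_eq_add_neg]
  congr 1
  set x := fstBlock p
  simp only [B.ricci_inr_inr hp]
  -- Contracting `G⁻¹` with `G ∂_k P_k` gives `tr ∂_k P_k`, so `G` itself disappears.
  have e : ∀ k, pd k (fun y => (P k y).trace) x =
      ∑ r, ∑ s, (G x)⁻¹ r s * ∑ u, G x r u * pd k (fun y => P k y u s) x := fun k => by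
    rw [(B.hasPD_trace hp k k).2]
    exact (B.trace_inv_mul hp (Matrix.of fun u s => pd k (fun y => P k y u s) x)).symm
  simp only [e]
  refine (sum_mul_sum_add ((G x)⁻¹ : Matrix τ τ ℝ) (fun k => pd k (fun y => (h k y)⁻¹) x +
    (∑ a, L a a k x + 1 / 2 * (P k x).trace) * (h k x)⁻¹) (fun k => (h k x)⁻¹)
    (fun k => G x * P k x) (fun k r s => ∑ u, G x r u * pd k (fun y => P k y u s) x)).trans ?_
  simp only [B.trace_inv_mul hp]

end IsBlockMetric
end Chart

/-! ### The curvature of the twisted product -/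

theorem differentiableAt_det {n : Type} [Fintype n] [DecidableEq n] {E : Type}
    [NormedAddCommGroup E] [NormedSpace ℝ E] {M : E → Matrix n n ℝ} {x : E}
    (h : ∀ r s, DifferentiableAt ℝ (fun y => M y r s) x) :
    DifferentiableAt ℝ (fun y => (M y).det) x := by
  simp only [Matrix.det_apply]
  refine DifferentiableAt.fun_sum fun σ _ => DifferentiableAt.const_smul ?_ _
  exact (HasFDerivAt.finsetProd (u := Finset.univ) fun i _ => (h (σ i) i).hasFDerivAt).differentiableAt

theorem differentiableAt_matrix_inv {n : Type} [Fintype n] [DecidableEq n] {E : Type}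
    [NormedAddCommGroup E] [NormedSpace ℝ E] {M : E → Matrix n n ℝ} {x : E}
    (h : ∀ r s, DifferentiableAt ℝ (fun y => M y r s) x) (h0 : IsUnit (M x).det) (r s : n) :
    DifferentiableAt ℝ (fun y => (M y)⁻¹ r s) x := by
  simp only [Matrix.inv_def, Matrix.smul_apply, Ring.inverse_eq_inv', smul_eq_mul,
    Matrix.adjugate_apply]
  refine ((differentiableAt_det h).inv h0.ne_zero).mul (differentiableAt_det fun a b => ?_)
  simp only [Matrix.updateRow_apply]
  split_ifs
  · exact differentiableAt_const _
  · exact h a b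

namespace TwistedProduct

open Chart

variable {m : ℕ} (e : Module.Basis (Fin (m + 1)) ℝ (productSegre m)) (A : Fin m → ℝ → ℝ)

/-- The logarithmic derivatives `∂_k ⟨μ, β⟩ / ⟨μ, β⟩`. -/
noncomputable def twistLog (k : Fin m) (x : Fin m → ℝ) : ℝ := segreSlope (e 0) k / segreMu x (e 0)

/-- The logarithmic derivatives `A_k' / A_k`. -/
noncomputable def profileLog (k : Fin m) (x : Fin m → ℝ) : ℝ := deriv (A k) (x k) / A k (x k)

/-- The matrix `θ P_i θ⁻¹`, where `P_i = G⁻¹ ∂_i G` for the matrix `G` of the metric on the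
`t`-directions. -/
noncomputable def frameLog (i : Fin m) (x : Fin m → ℝ) : Matrix (Fin m) (Fin m) ℝ :=
  Matrix.of fun j k => (if j = k then -twistLog e i x else 0) + (if i = k then -twistLog e j x else 0)
    + (if i = j then -(A k (x k) / A j (x j)) * twistLog e k x else 0)
    + (if i = j then if j = k then profileLog A i x else 0 else 0)

/-- The Christoffel symbols of `∑_j dx_j² / (A_j ⟨μ, β⟩)`. -/
noncomputable def baseChristoffel (a b c : Fin m) (x : Fin m → ℝ) : ℝ :=
  (1 / 2) * ((if a = c then -twistLog e b x else 0) + (if a = b then -twistLog e c x else 0)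
    + (if b = c then A a (x a) / A b (x b) * twistLog e a x else 0)
    - (if a = b then if a = c then profileLog A a x else 0 else 0))

/-- The domain of regularity of the coefficients of a twisted product. -/
structure IsRegularOn (U : Set (Fin m → ℝ)) : Prop where
  isOpen : IsOpen U
  segreMu_ne : ∀ x ∈ U, segreMu x (e 0) ≠ 0
  profile_ne : ∀ x ∈ U, ∀ j, A j (x j) ≠ 0
  profile_deriv : ∀ x ∈ U, ∀ j, HasDerivAt (A j) (deriv (A j) (x j)) (x j)
  profile_deriv2 : ∀ x ∈ U, ∀ j, HasDerivAt (deriv (A j)) (deriv (deriv (A j)) (x j)) (x j)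

namespace IsRegularOn

variable {e A} {U : Set (Fin m → ℝ)} {x : Fin m → ℝ}

theorem hasPD_profile (R : IsRegularOn e A U) (hx : x ∈ U) (i k : Fin m) :
    HasPD i (fun y => A k (y k)) (if k = i then A k (x k) * profileLog A k x else 0) x :=
  (hasPD_comp_apply i k (R.profile_deriv x hx k)).of_eq (by
    rw [profileLog, mul_div_cancel₀ _ (R.profile_ne x hx k)])

theorem hasPD_twistLog (R : IsRegularOn e A U) (hx : x ∈ U) (i k : Fin m) :
    HasPD i (twistLog e k) (-(twistLog e k x * twistLog e i x)) x :=
  ((hasPD_const i (segreSlope (e 0) k) x).div (hasPD_segreMu (e 0) i x)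
    (R.segreMu_ne x hx)).of_eq (by
      have := R.segreMu_ne x hx
      simp only [twistLog]; field_simp; ring)

theorem hasPD_profileLog (R : IsRegularOn e A U) (hx : x ∈ U) (i k : Fin m) :
    HasPD i (profileLog A k)
      (if k = i then deriv (deriv (A k)) (x k) / A k (x k) - profileLog A k x ^ 2 else 0) x :=
  ((hasPD_comp_apply i k (R.profile_deriv2 x hx k)).div
    (hasPD_comp_apply i k (R.profile_deriv x hx k)) (R.profile_ne x hx k)).of_eq (by
      have := R.profile_ne x hx k
      simp only [profileLog]
      split_ifs
      · field_simp
      · simp)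

/-- Column `r` of `θ` is the gradient of a quotient `u / f` of affine functions. As `u` and `f` have
no second derivatives, the Hessian of `u / f` is expressed through its gradient and the logarithmic
derivatives of `f`. -/
theorem hasPD_theta (R : IsRegularOn e A U) (hx : x ∈ U) (i j r : Fin m) :
    HasPD i (fun y => theta e y j r)
      (-(twistLog e i x * theta e x j r + twistLog e j x * theta e x i r)) x := by
  have h1 : ∀ y ∈ U, ∀ j, theta e y j r = (segreSlope (e r.succ) j -
      twistLog e j y * segreMu y (e r.succ)) * (segreMu y (e 0))⁻¹ := fun y hy j => by
    have := R.segreMu_ne y hy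
    rw [theta, Matrix.of_apply,
      ((hasPD_segreMu (e r.succ) j y).div (hasPD_segreMu (e 0) j y) this).2, twistLog]
    field_simp
  refine HasPD.congr_on ?_ R.isOpen hx fun y hy => h1 y hy j
  refine (((hasPD_const i _ x).sub ((R.hasPD_twistLog hx i j).mul
    (hasPD_segreMu _ i x))).mul ((hasPD_segreMu _ i x).inv (R.segreMu_ne x hx))).of_eq ?_
  have := R.segreMu_ne x hx
  rw [h1 x hx, h1 x hx]
  simp only [twistLog]
  field_simp
  ring

/-- A vector `v` in the kernel gives `η = ∑ v_r e_{r+1}` for which `⟨μ, η⟩ / f` has vanishing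
differential at `x`. Then `⟨μ, η⟩` and a multiple of `f` are affine functions with the same value
and gradient at `x`, so `η` is a multiple of `β = e₀`, and linear independence of the basis gives `v
= 0`. -/
theorem isUnit_det_theta (R : IsRegularOn e A U) (hx : x ∈ U) : IsUnit (theta e x).det := by
  rw [isUnit_iff_ne_zero]
  intro h0
  obtain ⟨v, hv, hv0⟩ := Matrix.exists_mulVec_eq_zero_iff.mpr h0
  have hf := R.segreMu_ne x hx
  set η := ∑ r, v r • e r.succ with hη
  have hmu : ∀ y, segreMu y η = ∑ r, v r * segreMu y (e r.succ) := fun y => by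
    simp [hη, map_sum]
  have hs : ∀ j, segreSlope η j = ∑ r, v r * segreSlope (e r.succ) j := fun j => by
    simp [segreSlope, hmu, mul_sub]
  have h1 : ∀ j, segreSlope η j * segreMu x (e 0) = segreMu x η * segreSlope (e 0) j := fun j => by
    have h2 : ∑ r, theta e x j r * v r = 0 := congrFun hv0 j
    have h3 : ∀ r, theta e x j r * v r = (v r * segreSlope (e r.succ) j * segreMu x (e 0) -
        v r * segreMu x (e r.succ) * segreSlope (e 0) j) / segreMu x (e 0) ^ 2 := fun r => by
      rw [theta, Matrix.of_apply,
        ((hasPD_segreMu (e r.succ) j x).div (hasPD_segreMu (e 0) j x) hf).2]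
      ring
    rw [Finset.sum_congr rfl fun r _ => h3 r, ← Finset.sum_div, div_eq_zero_iff,
      Finset.sum_sub_distrib, ← Finset.sum_mul, ← Finset.sum_mul, ← hs, ← hmu] at h2
    have := h2.resolve_right (pow_ne_zero 2 hf)
    linarith
  have h2 : η = (segreMu x η / segreMu x (e 0)) • e 0 := by
    refine eq_of_segreMu_eq fun y => ?_
    have h3 : ∀ ζ : productSegre m, segreMu y ζ = segreMu x ζ + ∑ k, segreSlope ζ k * (y k - x k) :=
      fun ζ => by
        rw [segreMu_eq y, segreMu_eq x]; simp [mul_sub]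
    have h4 : ∀ k, segreSlope η k = segreMu x η / segreMu x (e 0) * segreSlope (e 0) k := fun k => by
      field_simp; exact h1 k
    rw [map_smul, h3 η, h3 (e 0), smul_eq_mul, mul_add, div_mul_cancel₀ _ hf, Finset.mul_sum]
    simp only [h4, mul_assoc]
  apply hv
  ext s
  have h3 := congrArg (fun ζ => e.repr ζ s.succ) h2
  simpa [hη, Finsupp.single_apply, Fin.succ_ne_zero, Ne.symm (Fin.succ_ne_zero _)] using h3

end IsRegularOn
end TwistedProduct

/-! ### The twisted product as a block metric -/

namespace TwistedProduct

open Chart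

variable {m : ℕ} (e : Module.Basis (Fin (m + 1)) ℝ (productSegre m)) (A : Fin m → ℝ → ℝ)

/-- The coefficient of `dx_j²`. -/
noncomputable def baseCoeff (j : Fin m) (x : Fin m → ℝ) : ℝ := 1 / (A j (x j) * segreMu x (e 0))

/-- The matrix of the metric on the `t`-directions. -/
noncomputable def fibreMatrix (x : Fin m → ℝ) : Matrix (Fin m) (Fin m) ℝ :=
  Matrix.of fun r s => ∑ j, A j (x j) * segreMu x (e 0) * (theta e x j r * theta e x j s)

/-- The matrix `G⁻¹ ∂_i G` for the matrix `G` of the metric on the `t`-directions. -/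
noncomputable def fibreLog (i : Fin m) (x : Fin m → ℝ) : Matrix (Fin m) (Fin m) ℝ :=
  (theta e x)⁻¹ * frameLog e A i x * theta e x

theorem metric_eq_blockMetric :
    metric e A = blockMetric (baseCoeff e A) (fibreMatrix e A) := rfl

theorem fibreMatrix_eq (x : Fin m → ℝ) : fibreMatrix e A x = (theta e x).transpose *
    Matrix.diagonal (fun j => A j (x j) * segreMu x (e 0)) * theta e x := by
  ext r s
  rw [Matrix.mul_apply]
  simp only [fibreMatrix, Matrix.of_apply, Matrix.mul_diagonal, Matrix.transpose_apply]
  exact Finset.sum_congr rfl fun j _ => by ring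

namespace IsRegularOn

variable {e A} {U : Set (Fin m → ℝ)} {x : Fin m → ℝ}

theorem hasPD_baseCoeff (R : IsRegularOn e A U) (hx : x ∈ U) (i j : Fin m) :
    HasPD i (baseCoeff e A j) (baseCoeff e A j x *
      (-twistLog e i x - if i = j then profileLog A i x else 0)) x := by
  have hf := R.segreMu_ne x hx
  have hA := R.profile_ne x hx j
  refine ((hasPD_const i 1 x).div ((R.hasPD_profile hx i j).mul (hasPD_segreMu (e 0) i x))
    (mul_ne_zero hA hf)).of_eq ?_
  simp only [baseCoeff, twistLog]
  by_cases h : j = i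
  · subst h; simp; field_simp; ring
  · simp [h, Ne.symm h]; field_simp

theorem fibreMatrix_mul_fibreLog (R : IsRegularOn e A U) (hx : x ∈ U) (i : Fin m) :
    fibreMatrix e A x * fibreLog e A i x = (theta e x).transpose *
      (Matrix.diagonal (fun j => A j (x j) * segreMu x (e 0)) * frameLog e A i x) * theta e x := by
  rw [fibreMatrix_eq, fibreLog]
  simp only [Matrix.mul_assoc]
  rw [Matrix.mul_nonsing_inv_cancel_left _ _ (R.isUnit_det_theta hx)]

/-- With `D = diag(A_j f)` one has `G = θᵀ D θ`. By the product rule and `hasPD_theta`, `∂_i G = θᵀ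
M θ` for an explicit `M`, and `frameLog` is `D⁻¹ M`. -/
theorem hasPD_fibreMatrix (R : IsRegularOn e A U) (hx : x ∈ U) (i r s : Fin m) :
    HasPD i (fun y => fibreMatrix e A y r s) ((fibreMatrix e A x * fibreLog e A i x) r s) x := by
  have hf := R.segreMu_ne x hx
  rw [R.fibreMatrix_mul_fibreLog hx]
  simp only [fibreMatrix, Matrix.of_apply]
  refine (HasPD.sum fun j _ => ((R.hasPD_profile hx i j).mul (hasPD_segreMu (e 0) i x)).mul
    ((R.hasPD_theta hx i j r).mul (R.hasPD_theta hx i j s))).of_eq ?_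
  have hb : segreSlope (e 0) i = twistLog e i x * segreMu x (e 0) := by
    rw [twistLog, div_mul_cancel₀ _ hf]
  have h1 : ∀ j k, A j (x j) * segreMu x (e 0) * frameLog e A i x j k =
      segreMu x (e 0) * ((if j = k then -(A j (x j) * twistLog e i x) else 0) +
        (if i = k then -(A j (x j) * twistLog e j x) else 0) +
        (if i = j then -(A k (x k) * twistLog e k x) else 0) +
        (if i = j then if j = k then A i (x i) * profileLog A i x else 0 else 0)) := fun j k => by
    have hA := R.profile_ne x hx j
    simp only [frameLog, Matrix.of_apply]
    split_ifs with h1 h2 h3 h3 h2 h3 h3 <;> subst_vars <;> field_simp <;> ring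
  rw [Matrix.mul_apply]
  simp only [Matrix.mul_apply (M := (theta e x).transpose), Matrix.diagonal_mul, h1,
    Matrix.transpose_apply, hb]
  simp only [mul_add, add_mul, mul_ite, ite_mul, mul_zero, zero_mul, Finset.sum_add_distrib,
    Finset.sum_ite_eq, Finset.sum_ite_eq', Finset.mem_univ, if_true, Finset.sum_const_zero,
    Finset.sum_ite_irrel]
  rw [add_assoc, add_comm, Finset.sum_mul]
  simp only [← Finset.sum_add_distrib]
  congr 1
  · exact Finset.sum_congr rfl fun j _ => by ring
  · ring

/-- The trace is invariant under conjugation by `θ`, so `frameLog` suffices. The final sum cancels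
in the scalar curvature against the one in `sum_sum_baseChristoffel_mul`. -/
theorem trace_fibreLog_mul (R : IsRegularOn e A U) (hx : x ∈ U) (i : Fin m) :
    (fibreLog e A i x * fibreLog e A i x).trace =
      (m + 6) * twistLog e i x ^ 2 - 6 * profileLog A i x * twistLog e i x + profileLog A i x ^ 2
        + 2 * ∑ j, A j (x j) / A i (x i) * twistLog e j x ^ 2 := by
  have hu := R.isUnit_det_theta hx
  have hA := R.profile_ne x hx
  have : fibreLog e A i x * fibreLog e A i x =
      (theta e x)⁻¹ * (frameLog e A i x * frameLog e A i x) * theta e x := by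
    simp only [fibreLog, Matrix.mul_assoc]
    rw [Matrix.mul_nonsing_inv_cancel_left _ _ hu]
  rw [this, Matrix.trace_mul_cycle, Matrix.mul_nonsing_inv _ hu, Matrix.one_mul, Matrix.trace]
  simp only [Matrix.diag, Matrix.mul_apply, frameLog, Matrix.of_apply]
  simp only [mul_add, add_mul, mul_ite, ite_mul, mul_zero, zero_mul, Finset.sum_add_distrib,
    Finset.sum_ite_eq, Finset.sum_ite_eq', Finset.mem_univ, if_true, Finset.sum_const_zero,
    Finset.sum_ite_irrel, div_self (hA i), if_false, eq_self_iff_true]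
  have s1 : ∀ j, -(A j (x j) / A i (x i)) * twistLog e j x * -twistLog e j x =
    A j (x j) / A i (x i) * twistLog e j x ^ 2 := fun j => by ring
  have s2 : ∀ j, -twistLog e j x * (-(A j (x j) / A i (x i)) * twistLog e j x) =
    A j (x j) / A i (x i) * twistLog e j x ^ 2 := fun j => by ring
  simp only [s1, s2, Finset.sum_const, Finset.card_univ, Fintype.card_fin, nsmul_eq_mul]
  ring

theorem trace_fibreLog (R : IsRegularOn e A U) (hx : x ∈ U) (i : Fin m) :
    (fibreLog e A i x).trace = profileLog A i x - (m + 2) * twistLog e i x := by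
  have hu := R.isUnit_det_theta hx
  have hA := R.profile_ne x hx
  rw [fibreLog, Matrix.trace_mul_cycle, Matrix.mul_nonsing_inv _ hu, Matrix.one_mul, Matrix.trace]
  simp [frameLog, Finset.sum_add_distrib, hA]
  ring

theorem differentiableAt_frameLog (R : IsRegularOn e A U) (hx : x ∈ U) (i j k : Fin m) :
    DifferentiableAt ℝ (fun y => frameLog e A i y j k) x := by
  have h1 := fun a => (R.hasPD_twistLog hx i a).1
  have h2 := fun a => (R.hasPD_profileLog hx i a).1
  have h4 : DifferentiableAt ℝ (fun y => A k (y k) / A j (y j)) x :=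
    ((R.hasPD_profile hx i k).div (R.hasPD_profile hx i j) (R.profile_ne x hx j)).1
  simp only [frameLog, Matrix.of_apply]
  refine (((?_ : DifferentiableAt ℝ _ x).add ?_).add ?_).add ?_ <;> split_ifs
  all_goals first
    | exact differentiableAt_const _
    | exact (h1 _).neg
    | exact h2 _
    | exact h4.fun_neg.fun_mul (h1 _)

theorem differentiableAt_fibreLog (R : IsRegularOn e A U) (hx : x ∈ U) (i r s : Fin m) :
    DifferentiableAt ℝ (fun y => fibreLog e A i y r s) x := by
  have h1 := fun j k => (R.hasPD_theta hx i j k).1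
  simp only [fibreLog, Matrix.mul_apply]
  exact DifferentiableAt.fun_sum fun k _ => (DifferentiableAt.fun_sum fun j _ =>
    (differentiableAt_matrix_inv h1 (R.isUnit_det_theta hx) r j).mul
      (R.differentiableAt_frameLog hx i j k)).mul (h1 k s)

theorem differentiableAt_baseChristoffel (R : IsRegularOn e A U) (hx : x ∈ U) (a b c : Fin m) :
    DifferentiableAt ℝ (baseChristoffel e A a b c) x := by
  have h1 := fun j => (R.hasPD_twistLog hx a j).1
  have h2 := fun j => (R.hasPD_profileLog hx a j).1
  have h4 : DifferentiableAt ℝ (fun y => A a (y a) / A b (y b)) x :=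
    ((R.hasPD_profile hx a a).div (R.hasPD_profile hx a b) (R.profile_ne x hx b)).1
  unfold baseChristoffel
  refine DifferentiableAt.const_mul ((((?_ : DifferentiableAt ℝ _ x).add ?_).add ?_).sub ?_) _ <;>
    split_ifs
  all_goals first
    | exact differentiableAt_const _
    | exact (h1 _).neg
    | exact h2 _
    | exact h4.fun_mul (h1 _)

theorem isBlockMetric (R : IsRegularOn e A U) :
    IsBlockMetric U (baseCoeff e A) (fibreMatrix e A)
      (fun i j x => baseCoeff e A j x * (-twistLog e i x - if i = j then profileLog A i x else 0))
      (fibreLog e A) (baseChristoffel e A) where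
  isOpen := R.isOpen
  ne_zero x hx j := 
    one_div_ne_zero (mul_ne_zero (R.profile_ne x hx j) (R.segreMu_ne x hx))
  isUnit_det x hx := by
    have h := R.isUnit_det_theta hx
    rw [fibreMatrix_eq, Matrix.det_mul, Matrix.det_mul, Matrix.det_transpose, Matrix.det_diagonal]
    refine (h.mul ?_).mul h
    exact (Finset.prod_ne_zero_iff.mpr fun j _ =>
      mul_ne_zero (R.profile_ne x hx j) (R.segreMu_ne x hx)).isUnit
  symm x hx := by
    ext r s
    simp only [fibreMatrix, Matrix.transpose_apply, Matrix.of_apply, mul_comm]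
  hasPD_diag x hx i j := R.hasPD_baseCoeff hx i j
  hasPD_block x hx i r s := R.hasPD_fibreMatrix hx i r s
  differentiableAt_P x hx i r s := R.differentiableAt_fibreLog hx i r s
  differentiableAt_L x hx a b c := R.differentiableAt_baseChristoffel hx a b c
  L_eq x hx a b c := by
    have hf := R.segreMu_ne x hx
    have hA := R.profile_ne x hx a
    have hB := R.profile_ne x hx b
    simp only [baseChristoffel, baseCoeff]
    split_ifs <;> subst_vars <;> first | contradiction | (field_simp; try ring)

end IsRegularOn
end TwistedProduct

/-! ### Contractions and the scalar curvature of the twisted product -/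

namespace TwistedProduct

open Chart

variable {m : ℕ} {e : Module.Basis (Fin (m + 1)) ℝ (productSegre m)} {A : Fin m → ℝ → ℝ}

namespace IsRegularOn

variable {U : Set (Fin m → ℝ)} {x : Fin m → ℝ}

theorem sum_baseChristoffel (R : IsRegularOn e A U) (hx : x ∈ U) (k : Fin m) :
    ∑ a, baseChristoffel e A a a k x = -(1 / 2) * (m * twistLog e k x + profileLog A k x) := by
  have hA := R.profile_ne x hx
  simp [baseChristoffel, ← Finset.mul_sum, Finset.sum_add_distrib, hA]
  ring

theorem sum_pd_baseChristoffel (R : IsRegularOn e A U) (hx : x ∈ U) (i : Fin m) :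
    ∑ a, pd i (baseChristoffel e A a a i) x = (1 / 2) * (m * twistLog e i x ^ 2 -
      (deriv (deriv (A i)) (x i) / A i (x i) - profileLog A i x ^ 2)) := by
  have h1 := HasPD.sum (s := Finset.univ) fun a _ =>
    (R.differentiableAt_baseChristoffel hx a a i).hasPD i
  have h2 : HasPD i (fun y => -(1 / 2) * (m * twistLog e i y + profileLog A i y)) _ x :=
    ((R.hasPD_twistLog hx i i).const_mul (m : ℝ)).add (R.hasPD_profileLog hx i i) |>.const_mul _
  rw [h1.unique_on h2 R.isOpen hx fun y hy => R.sum_baseChristoffel hy i, if_pos rfl]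
  ring

theorem pd_trace_fibreLog (R : IsRegularOn e A U) (hx : x ∈ U) (i : Fin m) :
    pd i (fun y => (fibreLog e A i y).trace) x =
      deriv (deriv (A i)) (x i) / A i (x i) - profileLog A i x ^ 2 +
        (m + 2) * twistLog e i x ^ 2 := by
  have h2 : HasPD i (fun y => profileLog A i y - (m + 2) * twistLog e i y) _ x :=
    (R.hasPD_profileLog hx i i).sub ((R.hasPD_twistLog hx i i).const_mul ((m : ℝ) + 2))
  rw [(h2.congr_on R.isOpen hx fun y hy => R.trace_fibreLog hy i).2, if_pos rfl]
  ring

theorem baseChristoffel_diag (a i : Fin m) : baseChristoffel e A a i i = fun x =>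
    (1 / 2) * (A a (x a) / A i (x i) * twistLog e a x +
      if a = i then -2 * twistLog e i x - profileLog A i x else 0) := by
  ext x
  simp only [baseChristoffel]
  split_ifs <;> subst_vars <;> (simp; try ring)

theorem sum_pd_baseChristoffel_diag (R : IsRegularOn e A U) (hx : x ∈ U) (i : Fin m) :
    ∑ a, pd a (baseChristoffel e A a i i) x = (1 / 2) * (2 * twistLog e i x ^ 2
      - profileLog A i x * twistLog e i x
      - (deriv (deriv (A i)) (x i) / A i (x i) - profileLog A i x ^ 2)
      + ∑ a, A a (x a) / A i (x i) * (profileLog A a x * twistLog e a x - twistLog e a x ^ 2)) := by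
  have h1 : ∀ a, pd a (baseChristoffel e A a i i) x = (1 / 2) *
      (A a (x a) / A i (x i) * (profileLog A a x * twistLog e a x - twistLog e a x ^ 2) +
        if a = i then 2 * twistLog e i x ^ 2 - profileLog A i x * twistLog e i x
          - (deriv (deriv (A i)) (x i) / A i (x i) - profileLog A i x ^ 2) else 0) := fun a => by
    have hA := R.profile_ne x hx i
    have hq : HasPD a (fun y => A a (y a) / A i (y i)) _ x :=
      (R.hasPD_profile hx a a).div (R.hasPD_profile hx a i) hA
    rw [baseChristoffel_diag]
    by_cases h : a = i
    · subst h
      simp only [if_true]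
      refine (((hq.mul (R.hasPD_twistLog hx a a)).add
        (((R.hasPD_twistLog hx a a).const_mul (-2)).sub
          (R.hasPD_profileLog hx a a))).const_mul (1 / 2)).2.trans ?_
      simp only [if_true]
      field_simp
      ring
    · simp only [h, if_false, add_zero]
      refine ((hq.mul (R.hasPD_twistLog hx a a)).const_mul (1 / 2)).2.trans ?_
      simp only [if_true, Ne.symm h, if_false]
      field_simp
      ring
  simp only [h1, ← Finset.mul_sum, Finset.sum_add_distrib, Finset.sum_ite_eq', Finset.mem_univ,
    if_true]
  ring

theorem sum_sum_baseChristoffel_mul (R : IsRegularOn e A U) (hx : x ∈ U) (i : Fin m) :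
    ∑ a, ∑ k, baseChristoffel e A a i k x * baseChristoffel e A k a i x =
      (1 / 4) * ((m + 2) * twistLog e i x ^ 2 + 2 * twistLog e i x * profileLog A i x +
        profileLog A i x ^ 2 - 2 * ∑ k, A k (x k) / A i (x i) * twistLog e k x ^ 2) := by
  have hA := R.profile_ne x hx
  have h4 : ∀ a b : ℝ, 1 / 2 * a * (1 / 2 * b) = 1 / 4 * (a * b) := fun a b => by ring
  simp only [baseChristoffel, h4, ← Finset.mul_sum]
  congr 1
  simp only [mul_add, add_mul, mul_sub, sub_mul, mul_ite, ite_mul, mul_zero, zero_mul,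
    Finset.sum_add_distrib, Finset.sum_sub_distrib,
    Finset.sum_ite_eq, Finset.sum_ite_eq', Finset.mem_univ, if_true, Finset.sum_const_zero,
    Finset.sum_ite_irrel, div_self (hA i), if_false, eq_self_iff_true]
  have s1 : ∀ k, A k (x k) / A i (x i) * twistLog e k x * -twistLog e k x =
    -(A k (x k) / A i (x i) * twistLog e k x ^ 2) := fun k => by ring
  have s2 : ∀ k, -twistLog e k x * (A k (x k) / A i (x i) * twistLog e k x) =
    -(A k (x k) / A i (x i) * twistLog e k x ^ 2) := fun k => by ring
  simp only [s1, s2, Finset.sum_const, Finset.card_univ, Fintype.card_fin, nsmul_eq_mul,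
    Finset.sum_neg_distrib]
  ring

theorem sum_mul_baseChristoffel_diag (i : Fin m) :
    ∑ k, -((m + 1) * twistLog e k x) * baseChristoffel e A k i i x =
      -((m + 1) / 2) * (∑ k, A k (x k) / A i (x i) * twistLog e k x ^ 2
        - 2 * twistLog e i x ^ 2 - profileLog A i x * twistLog e i x) := by
  have h : ∀ k, -((m + 1) * twistLog e k x) * baseChristoffel e A k i i x =
      -((m + 1) / 2) * (A k (x k) / A i (x i) * twistLog e k x ^ 2 +
        if k = i then -2 * twistLog e i x ^ 2 - profileLog A i x * twistLog e i x else 0) := by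
    intro k
    rw [baseChristoffel_diag]
    split_ifs with h
    · subst h; ring
    · ring
  simp only [h, ← Finset.mul_sum, Finset.sum_add_distrib, Finset.sum_ite_eq', Finset.mem_univ,
    if_true]
  ring

/-- The scalar curvature of the twisted product. -/
theorem scalarCurvature_metric (R : IsRegularOn e A U) {p : Fin m ⊕ Fin m → ℝ}
    (hp : fstBlock p ∈ U) : scalarCurvature (metric e A) p =
      ∑ i, segreMu (fstBlock p) (e 0) * A i (fstBlock p i) *
        (-(deriv (deriv (A i)) (fstBlock p i) / A i (fstBlock p i)) +
          2 * (m + 1) * twistLog e i (fstBlock p) * profileLog A i (fstBlock p) -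
          (m + 1) * (m + 2) * twistLog e i (fstBlock p) ^ 2) := by
  rw [metric_eq_blockMetric, R.isBlockMetric.scalarCurvature_eq hp]
  set x := fstBlock p
  have hf := R.segreMu_ne x hp
  have hA := R.profile_ne x hp
  -- This is the logarithmic derivative of the volume density: the `A_k` cancel between base and
  -- fibre, leaving that of `f^{-(m+1)}`.
  have hV : ∀ k, -(1 / 2) * ((m : ℝ) * twistLog e k x + profileLog A k x) +
      1 / 2 * (profileLog A k x - (m + 2) * twistLog e k x) = -((m + 1) * twistLog e k x) :=
    fun k => by ring
  have hD : ∀ k, pd k (fun y => (baseCoeff e A k y)⁻¹) x =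
      (baseCoeff e A k x)⁻¹ * (twistLog e k x + profileLog A k x) := fun k => by
    have h0 := R.isBlockMetric.ne_zero x hp k
    rw [((R.hasPD_baseCoeff hp k k).inv h0).2, if_pos rfl]
    field_simp
    ring
  have hc : ∀ k, (baseCoeff e A k x)⁻¹ = segreMu x (e 0) * A k (x k) := fun k => by
    rw [baseCoeff, one_div, inv_inv, mul_comm]
  simp only [R.sum_baseChristoffel hp, R.trace_fibreLog hp, hV, R.sum_pd_baseChristoffel hp,
    R.pd_trace_fibreLog hp, R.sum_pd_baseChristoffel_diag hp, R.sum_sum_baseChristoffel_mul hp,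
    sum_mul_baseChristoffel_diag, R.trace_fibreLog_mul hp, hD, hc]
  have hS : ∀ (i : Fin m) (u : Fin m → ℝ), segreMu x (e 0) * A i (x i) *
      ∑ k, A k (x k) / A i (x i) * u k = ∑ k, segreMu x (e 0) * A k (x k) * u k := fun i u => by
    rw [Finset.mul_sum]
    refine Finset.sum_congr rfl fun k _ => ?_
    have := hA i
    field_simp
  set f := segreMu x (e 0)
  set φ := fun k => twistLog e k x with hφ
  set α := fun k => profileLog A k x with hα
  set q := fun k => deriv (deriv (A k)) (x k) / A k (x k) with hq
  -- Splits the `i`-th summand into a part local to `i` and a sum independent of `i`; the latter is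
  -- then counted `m` times.
  have key : ∀ i, f * A i (x i) *
      (1 / 2 * (2 * φ i ^ 2 - α i * φ i - (q i - α i ^ 2) +
          ∑ k, A k (x k) / A i (x i) * (α k * φ k - φ k ^ 2)) -
        1 / 2 * (m * φ i ^ 2 - (q i - α i ^ 2)) - 1 / 2 * (q i - α i ^ 2 + (m + 2) * φ i ^ 2) +
        -((m + 1) / 2) * (∑ k, A k (x k) / A i (x i) * φ k ^ 2 - 2 * φ i ^ 2 - α i * φ i) -
        1 / 4 * ((m + 2) * φ i ^ 2 + 2 * φ i * α i + α i ^ 2 -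
          2 * ∑ k, A k (x k) / A i (x i) * φ k ^ 2) -
        1 / 4 * ((m + 6) * φ i ^ 2 - 6 * α i * φ i + α i ^ 2 +
          2 * ∑ k, A k (x k) / A i (x i) * φ k ^ 2)) =
      f * A i (x i) * (-(1 / 2) * q i + (m + 2) / 2 * α i * φ i - 1 / 2 * φ i ^ 2 * (m + 2)) +
        (1 / 2 * ∑ k, f * A k (x k) * (α k * φ k - φ k ^ 2) -
          (m + 1) / 2 * ∑ k, f * A k (x k) * φ k ^ 2) := fun i => by
    rw [← hS i, ← hS i]; ring
  rw [Finset.sum_congr rfl fun i _ => key i, Finset.sum_add_distrib, Finset.sum_const,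
    Finset.card_univ, Fintype.card_fin, nsmul_eq_mul]
  simp only [Finset.mul_sum, ← Finset.sum_add_distrib, ← Finset.sum_sub_distrib]
  exact Finset.sum_congr rfl fun i _ => by ring

end IsRegularOn
end TwistedProduct

/-! ### Extremality as affineness of `-⟨μ, β⟩` times the scalar curvature -/

namespace Chart

variable {ι : Type} [Fintype ι] [DecidableEq ι]

/-- A function whose partial derivatives vanish on a preconnected open set is constant there. -/
theorem eq_of_hasPD_zero {U : Set (ι → ℝ)} (hU : IsOpen U) (hU' : IsPreconnected U)
    {F : (ι → ℝ) → ℝ} (h : ∀ x ∈ U, DifferentiableAt ℝ F x) (h0 : ∀ x ∈ U, ∀ i, pd i F x = 0)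
    {x y : ι → ℝ} (hx : x ∈ U) (hy : y ∈ U) : F x = F y := by
  refine hU.is_const_of_fderiv_eq_zero hU' (fun z hz => (h z hz).differentiableWithinAt)
    (fun z hz => ?_) hx hy
  have : (fderiv ℝ F z : (ι → ℝ) →ₗ[ℝ] ℝ) = 0 := by
    refine LinearMap.pi_ext' fun i => LinearMap.ext_ring ?_
    simpa [pd] using h0 z hz i
  ext v
  simpa using congrArg (fun l : (ι → ℝ) →ₗ[ℝ] ℝ => l v) this

theorem hasPD_sum_comp_apply {B B' : ι → ℝ → ℝ} {x : ι → ℝ} (c : ι → ℝ)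
    (h : ∀ k, HasDerivAt (B k) (B' k (x k)) (x k)) (i : ι) :
    HasPD i (fun y => ∑ k, c k * B k (y k)) (c i * B' i (x i)) x :=
  (HasPD.sum fun k _ => (hasPD_comp_apply i k (h k)).const_mul (c k)).of_eq (by simp)

end Chart

namespace TwistedProduct

open Chart

variable {m : ℕ} (e : Module.Basis (Fin (m + 1)) ℝ (productSegre m)) (A : Fin m → ℝ → ℝ)

/-- The product of `-⟨μ, β⟩` with the scalar curvature of the twisted product. -/
noncomputable def extremalDefect (x : Fin m → ℝ) : ℝ :=
  segreMu x (e 0) ^ 2 * ∑ k, deriv (deriv (A k)) (x k)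
    - 2 * (m + 1) * segreMu x (e 0) * ∑ k, segreSlope (e 0) k * deriv (A k) (x k)
    + (m + 1) * (m + 2) * ∑ k, segreSlope (e 0) k ^ 2 * A k (x k)

variable {e A} {U : Set (Fin m → ℝ)} {x : Fin m → ℝ}

theorem hasPD_extremalDefect (R : IsRegularOn e A U)
    (h3 : ∀ x ∈ U, ∀ j, HasDerivAt (deriv (deriv (A j))) (deriv (deriv (deriv (A j))) (x j)) (x j))
    (hx : x ∈ U) (i : Fin m) :
    HasPD i (extremalDefect e A)
      (2 * segreSlope (e 0) i * segreMu x (e 0) * ∑ k, deriv (deriv (A k)) (x k)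
        + segreMu x (e 0) ^ 2 * deriv (deriv (deriv (A i))) (x i)
        - 2 * (m + 1) * segreSlope (e 0) i * ∑ k, segreSlope (e 0) k * deriv (A k) (x k)
        - 2 * (m + 1) * segreMu x (e 0) * (segreSlope (e 0) i * deriv (deriv (A i)) (x i))
        + (m + 1) * (m + 2) * (segreSlope (e 0) i ^ 2 * deriv (A i) (x i))) x := by
  have hf := hasPD_segreMu (e 0) i x
  have hU := hasPD_sum_comp_apply (fun _ => 1) (B' := fun j => deriv (deriv (deriv (A j)))) (h3 x hx) i
  have hV := hasPD_sum_comp_apply (segreSlope (e 0)) (B' := fun j => deriv (deriv (A j)))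
    (R.profile_deriv2 x hx) i
  have hW := hasPD_sum_comp_apply (fun k => segreSlope (e 0) k ^ 2) (B' := fun j => deriv (A j))
    (R.profile_deriv x hx) i
  simp only [one_mul] at hU
  have h := (((hf.mul hf).mul hU).sub ((hf.const_mul (2 * ((m : ℝ) + 1))).mul hV)).add
    (hW.const_mul (((m : ℝ) + 1) * (m + 2)))
  simp only [← sq] at h
  exact h.of_eq (by ring)

theorem IsRegularOn.scalarCurvature_eq_neg_div (R : IsRegularOn e A U)
    {p : Fin m ⊕ Fin m → ℝ} (hp : fstBlock p ∈ U) :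
    scalarCurvature (metric e A) p =
      -extremalDefect e A (fstBlock p) / segreMu (fstBlock p) (e 0) := by
  have hf := R.segreMu_ne _ hp
  have hA := R.profile_ne _ hp
  rw [R.scalarCurvature_metric hp, eq_div_iff hf, extremalDefect]
  simp only [Finset.mul_sum, Finset.sum_mul, ← Finset.sum_add_distrib, ← Finset.sum_sub_distrib,
    ← Finset.sum_neg_distrib]
  refine Finset.sum_congr rfl fun i _ => ?_
  have := hA i
  simp only [twistLog, profileLog]
  field_simp
  ring

theorem symplecticForm_eq (p : Fin m ⊕ Fin m → ℝ) : symplecticForm e p =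
    Matrix.fromBlocks 0 (theta e (fstBlock p)) (-(theta e (fstBlock p)).transpose) 0 := rfl

theorem hasPD_div_segreMu (R : IsRegularOn e A U) (hx : x ∈ U) (j r : Fin m) :
    HasPD j (fun y => segreMu y (e r.succ) / segreMu y (e 0)) (theta e x j r) x :=
  ((hasPD_segreMu (e r.succ) j x).div (hasPD_segreMu (e 0) j x) (R.segreMu_ne x hx)).1.hasPD j

theorem segreMu_basis_sum (x : Fin m → ℝ) (c₀ : ℝ) (c : Fin m → ℝ) :
    segreMu x (c₀ • e 0 + ∑ r, c r • e r.succ) =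
      c₀ * segreMu x (e 0) + ∑ r, c r * segreMu x (e r.succ) := by
  simp [map_sum]

/-- The potential of a combination of the vector fields `∂/∂t_r`. -/
theorem hasPD_potential (R : IsRegularOn e A U) (hx : x ∈ U) (j : Fin m) (c₀ : ℝ) (c : Fin m → ℝ) :
    HasPD j (fun y => c₀ + ∑ r, c r * (segreMu y (e r.succ) / segreMu y (e 0)))
      (∑ r, c r * theta e x j r) x :=
  ((hasPD_const j c₀ x).add (HasPD.sum fun r _ =>
    (hasPD_div_segreMu R hx j r).const_mul (c r))).of_eq (zero_add _)

theorem hasPD_scalarCurvature (R : IsRegularOn e A U)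
    (h3 : ∀ x ∈ U, ∀ j, HasDerivAt (deriv (deriv (A j))) (deriv (deriv (deriv (A j))) (x j)) (x j))
    {p : Fin m ⊕ Fin m → ℝ} (hp : fstBlock p ∈ U) (j : Fin m) :
    HasPD (Sum.inl j) (scalarCurvature (metric e A))
      (pd j (fun y => -extremalDefect e A y / segreMu y (e 0)) (fstBlock p)) p := by
  have h := (((hasPD_extremalDefect R h3 hp j).neg.div (hasPD_segreMu (e 0) j _)
    (R.segreMu_ne _ hp)).1.hasPD j).comp_fstBlock
  exact h.congr_on R.isBlockMetric.isOpen_preimage hp fun q hq => R.scalarCurvature_eq_neg_div hq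

theorem pd_inr_scalarCurvature (r : Fin m) (p : Fin m ⊕ Fin m → ℝ) :
    pd (Sum.inr r) (scalarCurvature (metric e A)) p = 0 := by
  obtain ⟨F, hF⟩ := scalarCurvature_blockMetric_eq_comp (baseCoeff e A) (fibreMatrix e A)
  rw [metric_eq_blockMetric, funext hF]
  exact pd_inr_comp_fstBlock F r p

/-- Expanding `η` in the basis writes the scalar curvature `-⟨μ, η⟩ / f` as a constant plus a
constant combination of the components of `μ_β`. Its Hamiltonian field is the same combination of
the `∂/∂t_r`, which is Killing because the metric does not depend on `t`. -/
theorem isExtremal_of_extremalDefect_eq {I : Fin m → Set ℝ}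
    (R : IsRegularOn e A {x | ∀ j, x j ∈ I j})
    (h3 : ∀ x ∈ {x : Fin m → ℝ | ∀ j, x j ∈ I j}, ∀ j,
      HasDerivAt (deriv (deriv (A j))) (deriv (deriv (deriv (A j))) (x j)) (x j))
    (η : productSegre m)
    (hη : ∀ x : Fin m → ℝ, (∀ j, x j ∈ I j) → extremalDefect e A x = segreMu x η) :
    IsExtremal (metric e A) (symplecticForm e) (domain I) := by
  set c : Fin (m + 1) → ℝ := fun r => -e.repr η r with hc
  have hs : ∀ x : Fin m → ℝ, (∀ j, x j ∈ I j) → -extremalDefect e A x / segreMu x (e 0) =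
      c 0 + ∑ r : Fin m, c r.succ * (segreMu x (e r.succ) / segreMu x (e 0)) := fun x hx => by
    have hf := R.segreMu_ne x hx
    rw [hη x hx, div_eq_iff hf, add_mul, Finset.sum_mul]
    conv_lhs => rw [← e.sum_repr η, Fin.sum_univ_succ, segreMu_basis_sum]
    simp only [hc, neg_add, neg_mul, ← Finset.sum_neg_distrib]
    congr 1
    exact Finset.sum_congr rfl fun r _ => by field_simp
  refine ⟨fun _ => Sum.elim 0 fun r => c r.succ, contDiffOn_const, fun p hp b => ?_,
    fun p hp b d => ?_⟩
  · replace hp : fstBlock p ∈ {x : Fin m → ℝ | ∀ j, x j ∈ I j} := hp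
    rcases b with j | r
    · rw [(hasPD_scalarCurvature R h3 hp j).2, pd_congr_on R.isOpen hp hs,
        (hasPD_potential R hp j _ _).2]
      simp [symplecticForm_eq, Fintype.sum_sum_type, mul_comm]
    · simp [symplecticForm_eq, Fintype.sum_sum_type, pd_inr_scalarCurvature]
  · simp only [lieDerivative, Fintype.sum_sum_type, pd_const, mul_zero, add_zero, Sum.elim_inl,
      Sum.elim_inr, Pi.zero_apply, zero_mul, Finset.sum_const_zero, zero_add]
    exact Finset.sum_eq_zero fun r _ => by
      rw [metric_eq_blockMetric, IsBlockMetric.pd_inr, mul_zero]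

/-- The scalar curvature `s` does not depend on `t` and `θ` is invertible, so `K` has no
`x`-components and its `t`-components `θ⁻¹ ds` depend only on `x`. The mixed components of the
Killing equation read `G ∂_i K = 0`, hence `K` is constant. Thus `s` and `∑ c_r ⟨μ_β, e_r⟩` have
equal differentials on a convex set and differ by a constant; multiplying by `-f` gives an affine
function. -/
theorem exists_extremalDefect_eq {I : Fin m → Set ℝ} (hIne : ∀ j, (I j).Nonempty)
    (hIconn : ∀ j, (I j).OrdConnected) (R : IsRegularOn e A {x | ∀ j, x j ∈ I j})
    (h3 : ∀ x ∈ {x : Fin m → ℝ | ∀ j, x j ∈ I j}, ∀ j,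
      HasDerivAt (deriv (deriv (A j))) (deriv (deriv (deriv (A j))) (x j)) (x j))
    (h : IsExtremal (metric e A) (symplecticForm e) (domain I)) :
    ∃ η : productSegre m, ∀ x : Fin m → ℝ, (∀ j, x j ∈ I j) →
      extremalDefect e A x = segreMu x η := by
  obtain ⟨K, hK, hΩ, hL⟩ := h
  set U : Set (Fin m → ℝ) := {x | ∀ j, x j ∈ I j} with hU
  set s : (Fin m → ℝ) → ℝ := fun y => -extremalDefect e A y / segreMu y (e 0) with hs
  have hUconv : Convex ℝ U := by
    have : U = Set.univ.pi I := by ext; simp [hU]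
    rw [this]
    exact convex_pi fun j _ => (hIconn j).convex
  have hM : domain I = {p : Fin m ⊕ Fin m → ℝ | fstBlock p ∈ U} := rfl
  have hMopen : IsOpen (domain I) := R.isBlockMetric.isOpen_preimage
  have hMconv : Convex ℝ (domain I) := hUconv.linear_preimage (fstBlock : (Fin m ⊕ Fin m → ℝ) →L[ℝ] (Fin m → ℝ)).toLinearMap
  have hKd : ∀ p ∈ domain I, ∀ a, DifferentiableAt ℝ (fun q => K q a) p := fun p hp a =>
    differentiableAt_pi.mp ((hK.contDiffAt (hMopen.mem_nhds hp)).differentiableAt (by simp)) a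
  have hKx : ∀ p ∈ domain I, ∀ j, K p (Sum.inl j) = 0 := fun p hp j => by
    have h1 : Matrix.vecMul (fun j => K p (Sum.inl j)) (theta e (fstBlock p)) = 0 := by
      ext r
      have := hΩ p hp (Sum.inr r)
      rw [pd_inr_scalarCurvature] at this
      simpa [symplecticForm_eq, hs, Fintype.sum_sum_type, Matrix.vecMul, dotProduct, mul_comm] using this
    have h2 := congrArg (fun v => Matrix.vecMul v (theta e (fstBlock p))⁻¹) h1
    simp only [Matrix.vecMul_vecMul, Matrix.mul_nonsing_inv _ (R.isUnit_det_theta (x := fstBlock p) hp),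
      Matrix.vecMul_one, Matrix.zero_vecMul] at h2
    exact congrFun h2 j
  have hKt : ∀ p ∈ domain I, ∀ j, ∑ r, theta e (fstBlock p) j r * K p (Sum.inr r) =
      pd j s (fstBlock p) := fun p hp j => by
    have := hΩ p hp (Sum.inl j)
    rw [(hasPD_scalarCurvature R h3 hp j).2] at this
    simpa [symplecticForm_eq, hs, Fintype.sum_sum_type] using this
  have hKt' : ∀ p ∈ domain I, ∀ r, K p (Sum.inr r) =
      Matrix.mulVec (theta e (fstBlock p))⁻¹ (fun j => pd j s (fstBlock p)) r := fun p hp r => by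
    have h1 : Matrix.mulVec (theta e (fstBlock p)) (fun r => K p (Sum.inr r)) =
      fun j => pd j s (fstBlock p) := funext fun j => hKt p hp j
    rw [← h1, Matrix.mulVec_mulVec, Matrix.nonsing_inv_mul _ (R.isUnit_det_theta (x := fstBlock p) hp),
      Matrix.one_mulVec]
  have hinr : ∀ p ∈ domain I, ∀ r u, pd (Sum.inr u) (fun q => K q (Sum.inr r)) p = 0 :=
    fun p hp r u => by
      rw [pd_congr_on hMopen hp fun q hq => hKt' q hq r]
      exact pd_inr_comp_fstBlock (fun x => Matrix.mulVec (theta e x)⁻¹ (fun j => pd j s x) r) u p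
  have hinl : ∀ p ∈ domain I, ∀ r i, pd (Sum.inl i) (fun q => K q (Sum.inr r)) p = 0 :=
    fun p hp r i => by
      have h1 : Matrix.vecMul (fun r => pd (Sum.inl i) (fun q => K q (Sum.inr r)) p)
          (fibreMatrix e A (fstBlock p)) = 0 := by
        ext u
        have h2 := hL p hp (Sum.inl i) (Sum.inr u)
        have h3 : ∀ j, pd (Sum.inr u) (fun q => K q (Sum.inl j)) p = 0 := fun j => by
          rw [pd_congr_on hMopen hp fun q hq => hKx q hq j, pd_const]
        simp only [metric_eq_blockMetric, lieDerivative, Fintype.sum_sum_type,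
          IsBlockMetric.pd_mixed, h3] at h2
        simpa [blockMetric, Matrix.vecMul, dotProduct, mul_comm] using h2
      have h2 := congrArg (fun v => Matrix.vecMul v (fibreMatrix e A (fstBlock p))⁻¹) h1
      simp only [Matrix.vecMul_vecMul,
        Matrix.mul_nonsing_inv _ (R.isBlockMetric.isUnit_det (fstBlock p) hp),
        Matrix.vecMul_one, Matrix.zero_vecMul] at h2
      exact congrFun h2 r
  choose x₀ hx₀ using hIne
  have hp₀ : Sum.elim x₀ 0 ∈ domain I := hx₀
  set c : Fin m → ℝ := fun r => K (Sum.elim x₀ 0) (Sum.inr r) with hc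
  have hKc : ∀ p ∈ domain I, ∀ r, K p (Sum.inr r) = c r := fun p hp r =>
    eq_of_hasPD_zero (F := fun q => K q (Sum.inr r)) hMopen hMconv.isPreconnected
      (fun q hq => hKd q hq _)
      (fun q hq a => by rcases a with i | u; exacts [hinl q hq r i, hinr q hq r u]) hp hp₀
  have hsd : ∀ x ∈ U, ∀ j, HasPD j s (pd j s x) x := fun x hx j =>
    ((hasPD_extremalDefect R h3 hx j).neg.div (hasPD_segreMu (e 0) j _)
      (R.segreMu_ne _ hx)).1.hasPD j
  set F : (Fin m → ℝ) → ℝ := fun y =>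
    s y - (0 + ∑ r, c r * (segreMu y (e r.succ) / segreMu y (e 0))) with hF
  have hFd : ∀ x ∈ U, ∀ j, HasPD j F 0 x := fun x hx j => by
    refine ((hsd x hx j).sub (hasPD_potential R hx j 0 c)).of_eq ?_
    have h1 := hKt (Sum.elim x 0) hx j
    have h2 : fstBlock (Sum.elim x 0 : Fin m ⊕ Fin m → ℝ) = x := rfl
    rw [h2] at h1
    rw [← h1, sub_eq_zero]
    refine Finset.sum_congr rfl fun r _ => ?_
    rw [hKc (Sum.elim x 0) hx r, mul_comm]
  have hFc : ∀ x ∈ U, F x = F x₀ := fun x hx =>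
    eq_of_hasPD_zero R.isOpen hUconv.isPreconnected
      (fun y hy => by
        -- Without coordinates there is no partial derivative to read differentiability from.
        by_cases hm : Nonempty (Fin m)
        · exact (hFd y hy hm.some).1
        · have := not_nonempty_iff.mp hm
          exact ((hasFDerivAt_of_subsingleton F y)).differentiableAt)
      (fun y hy j => (hFd y hy j).2) hx hx₀
  refine ⟨(-F x₀) • e 0 + ∑ r, (-c r) • e r.succ, fun x hx => ?_⟩
  have hf := R.segreMu_ne x hx
  have h1 := hFc x hx
  simp only [hF, hs, zero_add, sub_eq_iff_eq_add] at h1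
  rw [div_eq_iff hf, add_mul, Finset.sum_mul] at h1
  rw [segreMu_basis_sum, ← neg_inj, h1]
  simp only [hF, hs, zero_add, neg_add, neg_mul, neg_neg, Finset.sum_neg_distrib]
  congr 1
  exact Finset.sum_congr rfl fun r _ => by field_simp

end TwistedProduct

/-! ### Functions of one variable -/

section OneVariable

variable {f g : ℝ → ℝ} {I : Set ℝ}

theorem deriv_eq_of_eqOn (hI : IsOpen I) {f' : ℝ → ℝ} (h : ∀ x ∈ I, f x = g x)
    (hg : ∀ x ∈ I, HasDerivAt g (f' x) x) : ∀ x ∈ I, deriv f x = f' x := fun x hx => by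
  rw [Filter.EventuallyEq.deriv_eq (Filter.eventuallyEq_of_mem (hI.mem_nhds hx) h), (hg x hx).deriv]

theorem ContDiffOn.deriv_of_isOpen_infty (hI : IsOpen I) (hf : ContDiffOn ℝ ∞ f I) :
    ContDiffOn ℝ ∞ (deriv f) I :=
  hf.deriv_of_isOpen hI (by simp)

theorem ContDiffOn.hasDerivAt_infty (hI : IsOpen I) (hf : ContDiffOn ℝ ∞ f I) :
    ∀ x ∈ I, HasDerivAt f (deriv f x) x := fun _ hx =>
  ((hf.contDiffAt (hI.mem_nhds hx)).differentiableAt (by simp)).hasDerivAt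

theorem eq_of_hasDerivAt_zero (hI : IsOpen I) (hI' : I.OrdConnected)
    (h : ∀ x ∈ I, HasDerivAt f 0 x) {x y : ℝ} (hx : x ∈ I) (hy : y ∈ I) : f x = f y :=
  hI.is_const_of_deriv_eq_zero hI'.isPreconnected
    (fun z hz => (h z hz).differentiableAt.differentiableWithinAt) (fun z hz => (h z hz).deriv) hx hy

theorem Polynomial.exists_derivative_eq {d : ℕ} (q : Polynomial ℝ) (hq : q.natDegree ≤ d) :
    ∃ Q : Polynomial ℝ, Q.natDegree ≤ d + 1 ∧ Q.derivative = q := by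
  refine ⟨∑ k ∈ Finset.range (d + 1), Polynomial.C (q.coeff k / (k + 1)) * Polynomial.X ^ (k + 1),
    ?_, ?_⟩
  · refine Polynomial.natDegree_sum_le_of_forall_le _ _ fun k hk => ?_
    exact (Polynomial.natDegree_C_mul_X_pow_le _ _).trans (by simpa using hk)
  · conv_rhs => rw [q.as_sum_range' (d + 1) (by omega)]
    simp only [Polynomial.derivative_sum, Polynomial.derivative_C_mul_X_pow]
    refine Finset.sum_congr rfl fun k _ => ?_
    rw [← Polynomial.C_mul_X_pow_eq_monomial]
    have : (k : ℝ) + 1 ≠ 0 := by positivity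
    simp [div_mul_cancel₀ _ this]

theorem IsPolynomialOn.of_deriv (hI : IsOpen I) (hI' : I.OrdConnected) {d : ℕ}
    (hf : ∀ x ∈ I, HasDerivAt f (deriv f x) x) (h : IsPolynomialOn d (deriv f) I) :
    IsPolynomialOn (d + 1) f I := by
  obtain ⟨q, hq, hfq⟩ := h
  obtain ⟨Q, hQ, rfl⟩ := q.exists_derivative_eq hq
  rcases I.eq_empty_or_nonempty with rfl | ⟨x₀, hx₀⟩
  · exact ⟨0, by simp, by simp⟩
  refine ⟨Q + Polynomial.C (f x₀ - Q.eval x₀), ?_, fun x hx => ?_⟩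
  · exact (Polynomial.natDegree_add_le _ _).trans (by simpa using hQ)
  · have := eq_of_hasDerivAt_zero hI hI' (f := fun y => f y - Q.eval y)
      (fun y hy => ((hf y hy).sub (Q.hasDerivAt y)).congr_deriv (by rw [hfq y hy, sub_self])) hx hx₀
    simp only [Polynomial.eval_add, Polynomial.eval_C]
    linarith

theorem isPolynomialOn_zero_of_deriv (hI : IsOpen I) (hI' : I.OrdConnected)
    (hf : ∀ x ∈ I, HasDerivAt f 0 x) : IsPolynomialOn 0 f I := by
  rcases I.eq_empty_or_nonempty with rfl | ⟨x₀, hx₀⟩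
  · exact ⟨0, by simp, by simp⟩
  · exact ⟨Polynomial.C (f x₀), by simp, fun x hx => by
      simpa using eq_of_hasDerivAt_zero hI hI' hf hx hx₀⟩

theorem isPolynomialOn_of_iterate_deriv (hI : IsOpen I) (hI' : I.OrdConnected) (d : ℕ) :
    ∀ f : ℝ → ℝ, ContDiffOn ℝ ∞ f I → (∀ x ∈ I, deriv^[d + 1] f x = 0) → IsPolynomialOn d f I := by
  induction d with
  | zero =>
    intro f hf h
    exact isPolynomialOn_zero_of_deriv hI hI' fun x hx => by
      simpa using (hf.hasDerivAt_infty hI x hx).congr_deriv (h x hx)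
  | succ d ih =>
    intro f hf h
    exact IsPolynomialOn.of_deriv hI hI' (hf.hasDerivAt_infty hI)
      (ih _ (hf.deriv_of_isOpen_infty hI) h)

theorem IsPolynomialOn.exists_coeff {d : ℕ} (h : IsPolynomialOn d f I) :
    ∃ c : ℕ → ℝ, ∀ x ∈ I, f x = ∑ k ∈ Finset.range (d + 1), c k * x ^ k := by
  obtain ⟨q, hq, h⟩ := h
  exact ⟨q.coeff, fun x hx => by
    rw [h x hx, Polynomial.eval_eq_sum_range' (Nat.lt_succ_of_le hq)]⟩

theorem hasDerivAt_sum_pow (c : ℕ → ℝ) (d : ℕ) (x : ℝ) :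
    HasDerivAt (fun y => ∑ k ∈ Finset.range (d + 1), c k * y ^ k)
      (∑ k ∈ Finset.range d, (k + 1) * c (k + 1) * x ^ k) x := by
  refine (HasDerivAt.fun_sum fun k _ => (hasDerivAt_pow k x).const_mul (c k)).congr_deriv ?_
  rw [Finset.sum_range_succ']
  simp only [CharP.cast_eq_zero, zero_mul, mul_zero, add_zero]
  refine Finset.sum_congr rfl fun k _ => ?_
  push_cast
  ring

/-- The derivatives of a function that is given by a polynomial. -/
theorem deriv_eq_of_eq_sum_pow (hI : IsOpen I) {c : ℕ → ℝ} {d : ℕ}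
    (h : ∀ x ∈ I, f x = ∑ k ∈ Finset.range (d + 1), c k * x ^ k) :
    ∀ x ∈ I, deriv f x = ∑ k ∈ Finset.range d, (k + 1) * c (k + 1) * x ^ k :=
  deriv_eq_of_eqOn hI h fun x _ => hasDerivAt_sum_pow c d x

/-- The operator `f ↦ g^{N+3} (f / g^{N+1})''` for `g(x) = a + b x`. -/
noncomputable def twistOperator (N : ℕ) (a b : ℝ) (f : ℝ → ℝ) (x : ℝ) : ℝ :=
  (a + b * x) ^ 2 * deriv (deriv f) x - 2 * (N + 1) * b * (a + b * x) * deriv f x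
    + (N + 1) * (N + 2) * b ^ 2 * f x

theorem hasDerivAt_affine_pow (a b : ℝ) (n : ℕ) (x : ℝ) :
    HasDerivAt (fun y => (a + b * y) ^ (n + 1)) ((n + 1) * (a + b * x) ^ n * b) x := by
  have h : HasDerivAt (fun y : ℝ => a + b * y) b x := by
    simpa using ((hasDerivAt_id x).const_mul b).const_add a
  exact (h.fun_pow (n + 1)).congr_deriv (by simp)

/-- Differentiating `f / g^{N+1}` twice for `g = a + b x` gives the operator divided by `g^{N+3}`.
Together with `twistOperator_eq_of_isDoubleIntegralOn`, solving the differential equation amounts to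
integrating twice. -/
theorem isDoubleIntegralOn_div (hI : IsOpen I) (hf : ContDiffOn ℝ ∞ f I) (N : ℕ) {a b : ℝ}
    (h0 : ∀ x ∈ I, a + b * x ≠ 0) :
    IsDoubleIntegralOn (fun x => f x / (a + b * x) ^ (N + 1))
      (fun x => twistOperator N a b f x / (a + b * x) ^ (N + 3)) I := by
  have h1 := hf.hasDerivAt_infty hI
  have h2 := (hf.deriv_of_isOpen_infty hI).hasDerivAt_infty hI
  refine ⟨fun x => deriv f x / (a + b * x) ^ (N + 1) - (N + 1) * b * (f x / (a + b * x) ^ (N + 2)),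
    fun x hx => ?_, fun x hx => ?_⟩
  · have hx0 := h0 x hx
    refine ((h1 x hx).div (hasDerivAt_affine_pow a b N x) (pow_ne_zero _ hx0)).congr_deriv ?_
    field_simp
    ring
  · have hx0 := h0 x hx
    refine (((h2 x hx).div (hasDerivAt_affine_pow a b N x) (pow_ne_zero _ hx0)).sub
      (((h1 x hx).div (hasDerivAt_affine_pow a b (N + 1) x)
        (pow_ne_zero _ hx0)).const_mul _)).congr_deriv ?_
    simp only [twistOperator]
    push_cast
    field_simp
    ring

theorem twistOperator_eq_of_isDoubleIntegralOn (hI : IsOpen I) (hf : ContDiffOn ℝ ∞ f I) (N : ℕ)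
    {a b : ℝ} (h0 : ∀ x ∈ I, a + b * x ≠ 0) {F Υ : ℝ → ℝ}
    (hF : IsDoubleIntegralOn F (fun x => Υ x / (a + b * x) ^ (N + 3)) I)
    (hfF : ∀ x ∈ I, f x = (a + b * x) ^ (N + 1) * F x) :
    ∀ x ∈ I, twistOperator N a b f x = Υ x := fun x hx => by
  obtain ⟨G, hG, hG'⟩ := hF
  obtain ⟨G₂, hG₂, hG₂'⟩ := isDoubleIntegralOn_div hI hf N h0
  have e1 : ∀ y ∈ I, f y / (a + b * y) ^ (N + 1) = F y := fun y hy => by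
    rw [hfF y hy, mul_div_cancel_left₀ _ (pow_ne_zero _ (h0 y hy))]
  have e2 : ∀ y ∈ I, G₂ y = G y := fun y hy => by
    rw [← (hG₂ y hy).deriv]; exact deriv_eq_of_eqOn hI e1 hG y hy
  have e3 := deriv_eq_of_eqOn hI e2 hG' x hx
  rw [(hG₂' x hx).deriv] at e3
  exact (div_left_inj' (pow_ne_zero _ (h0 x hx))).mp e3

/-- The explicit form of `(a + b x)^{N+1} ∫∫ (γ₀ + γ₁ x + γ₂ x²) / (a + b x)^{N+3}`. -/
theorem exists_explicit_of_isDoubleIntegralOn (hI : IsOpen I) (hI' : I.OrdConnected) {N : ℕ}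
    (hN : 2 ≤ N) {a b : ℝ} (hb : b ≠ 0) (h0 : ∀ x ∈ I, a + b * x ≠ 0) {F : ℝ → ℝ}
    (γ₀ γ₁ γ₂ : ℝ) (hF : IsDoubleIntegralOn F
      (fun x => (γ₀ + γ₁ * x + γ₂ * x ^ 2) / (a + b * x) ^ (N + 3)) I)
    (hfF : ∀ x ∈ I, f x = (a + b * x) ^ (N + 1) * F x) :
    ∃ (q : Polynomial ℝ) (ν₀ ν₁ : ℝ), q.natDegree ≤ 2 ∧
      ∀ x ∈ I, f x = q.eval x + (a + b * x) ^ (N + 1) * (ν₀ + ν₁ * x) := by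
  obtain ⟨G, hG, hG'⟩ := hF
  obtain ⟨n, rfl⟩ : ∃ n, N = n + 2 := ⟨N - 2, by omega⟩
  rcases I.eq_empty_or_nonempty with rfl | ⟨x₀, hx₀⟩
  · exact ⟨0, 0, 0, by simp, by simp⟩
  -- The `u_k` are the coefficients of `Υ` in powers of `g = a + b x`. Then `Υ / g^{N+3}` is a
  -- combination of `g^{-(N+3)}`, `g^{-(N+2)}` and `g^{-(N+1)}`, and for `N ≥ 2` two integrations
  -- produce no logarithm. The `w_k` below divide by the resulting factors.
  set u₂ : ℝ := γ₂ / b ^ 2 with hu₂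
  set u₁ : ℝ := γ₁ / b - 2 * a * u₂ with hu₁
  set u₀ : ℝ := γ₀ - a * u₁ - a ^ 2 * u₂ with hu₀
  have hΥ : ∀ x, γ₀ + γ₁ * x + γ₂ * x ^ 2 =
      u₀ + u₁ * (a + b * x) + u₂ * (a + b * x) ^ 2 := fun x => by
    have e2 : γ₂ = u₂ * b ^ 2 := by rw [hu₂]; field_simp
    have e1 : γ₁ = (u₁ + 2 * a * u₂) * b := by rw [hu₁]; field_simp; ring
    rw [e1, e2, show γ₀ = u₀ + a * u₁ + a ^ 2 * u₂ by rw [hu₀]; ring]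
    ring
  set w₀ : ℝ := u₀ / (b ^ 2 * (n + 4) * (n + 3)) with hw₀
  set w₁ : ℝ := u₁ / (b ^ 2 * (n + 3) * (n + 2)) with hw₁
  set w₂ : ℝ := u₂ / (b ^ 2 * (n + 2) * (n + 1)) with hw₂
  have n1 : (n : ℝ) + 1 ≠ 0 := by positivity
  have n2 : (n : ℝ) + 2 ≠ 0 := by positivity
  have n3 : (n : ℝ) + 3 ≠ 0 := by positivity
  have n4 : (n : ℝ) + 4 ≠ 0 := by positivity
  have v₀ : u₀ = w₀ * (b ^ 2 * (n + 4) * (n + 3)) := by rw [hw₀]; field_simp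
  have v₁ : u₁ = w₁ * (b ^ 2 * (n + 3) * (n + 2)) := by rw [hw₁]; field_simp
  have v₂ : u₂ = w₂ * (b ^ 2 * (n + 2) * (n + 1)) := by rw [hw₂]; field_simp
  have hinv : ∀ (k : ℕ), ∀ x ∈ I, HasDerivAt (fun y => ((a + b * y) ^ (k + 1))⁻¹)
      (-(k + 1) * b * ((a + b * x) ^ (k + 2))⁻¹) x := fun k x hx => by
    have hx0 := h0 x hx
    refine ((hasDerivAt_affine_pow a b k x).inv (pow_ne_zero _ hx0)).congr_deriv ?_
    field_simp
    ring
  have hG1 : ∀ x ∈ I, G x - (w₀ * (-(n + 3) * b * ((a + b * x) ^ (n + 4))⁻¹) +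
      w₁ * (-(n + 2) * b * ((a + b * x) ^ (n + 3))⁻¹) +
      w₂ * (-(n + 1) * b * ((a + b * x) ^ (n + 2))⁻¹)) = G x₀ -
      (w₀ * (-(n + 3) * b * ((a + b * x₀) ^ (n + 4))⁻¹) +
      w₁ * (-(n + 2) * b * ((a + b * x₀) ^ (n + 3))⁻¹) +
      w₂ * (-(n + 1) * b * ((a + b * x₀) ^ (n + 2))⁻¹)) := fun x hx => by
    refine eq_of_hasDerivAt_zero hI hI' (f := fun x => G x -
      (w₀ * (-(n + 3) * b * ((a + b * x) ^ (n + 4))⁻¹) +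
      w₁ * (-(n + 2) * b * ((a + b * x) ^ (n + 3))⁻¹) +
      w₂ * (-(n + 1) * b * ((a + b * x) ^ (n + 2))⁻¹))) (fun y hy => ?_) hx hx₀
    have hy0 := h0 y hy
    refine ((hG' y hy).sub ((((hinv (n + 3) y hy).const_mul _).const_mul w₀ |>.add
      (((hinv (n + 2) y hy).const_mul _).const_mul w₁)).add
      (((hinv (n + 1) y hy).const_mul _).const_mul w₂))).congr_deriv ?_
    simp only [hΥ, v₀, v₁, v₂]
    push_cast
    field_simp
    ring
  set ν₁ := G x₀ - (w₀ * (-(n + 3) * b * ((a + b * x₀) ^ (n + 4))⁻¹) +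
      w₁ * (-(n + 2) * b * ((a + b * x₀) ^ (n + 3))⁻¹) +
      w₂ * (-(n + 1) * b * ((a + b * x₀) ^ (n + 2))⁻¹))
  have hF1 : ∀ x ∈ I, F x - (w₀ * ((a + b * x) ^ (n + 3))⁻¹ + w₁ * ((a + b * x) ^ (n + 2))⁻¹ +
      w₂ * ((a + b * x) ^ (n + 1))⁻¹ + ν₁ * x) = F x₀ - (w₀ * ((a + b * x₀) ^ (n + 3))⁻¹ +
      w₁ * ((a + b * x₀) ^ (n + 2))⁻¹ + w₂ * ((a + b * x₀) ^ (n + 1))⁻¹ + ν₁ * x₀) := fun x hx => by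
    refine eq_of_hasDerivAt_zero hI hI' (f := fun x => F x - (w₀ * ((a + b * x) ^ (n + 3))⁻¹ +
      w₁ * ((a + b * x) ^ (n + 2))⁻¹ + w₂ * ((a + b * x) ^ (n + 1))⁻¹ + ν₁ * x))
      (fun y hy => ?_) hx hx₀
    refine ((hG y hy).sub (((((hinv (n + 2) y hy).const_mul w₀).add
      ((hinv (n + 1) y hy).const_mul w₁)).add ((hinv n y hy).const_mul w₂)).add
      ((hasDerivAt_id y).const_mul ν₁))).congr_deriv ?_
    rw [← hG1 y hy]
    push_cast
    ring
  set ν₀ := F x₀ - (w₀ * ((a + b * x₀) ^ (n + 3))⁻¹ +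
      w₁ * ((a + b * x₀) ^ (n + 2))⁻¹ + w₂ * ((a + b * x₀) ^ (n + 1))⁻¹ + ν₁ * x₀)
  -- The polynomial is `w₀ + w₁ g + w₂ g²` expanded in `x`; `ν₀` and `ν₁` are the constants of
  -- integration.
  refine ⟨Polynomial.C (w₂ * b ^ 2) * Polynomial.X ^ 2 +
    Polynomial.C (w₁ * b + 2 * w₂ * a * b) * Polynomial.X +
    Polynomial.C (w₀ + w₁ * a + w₂ * a ^ 2), ν₀, ν₁, Polynomial.natDegree_quadratic_le,
    fun x hx => ?_⟩
  have hx0 := h0 x hx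
  have h1 := hF1 x hx
  rw [sub_eq_iff_eq_add] at h1
  rw [hfF x hx, h1]
  simp only [Polynomial.eval_add, Polynomial.eval_mul, Polynomial.eval_C, Polynomial.eval_pow,
    Polynomial.eval_X]
  field_simp
  ring

end OneVariable

/-! ### The extremality equation -/

namespace TwistedProduct

open Chart

variable {m : ℕ}

/-- The functions `A_j` are smooth and nowhere zero on the open sets `I_j`, and `⟨μ, β⟩` is nowhere
zero on their product. -/
structure IsSmoothOn (e : Module.Basis (Fin (m + 1)) ℝ (productSegre m)) (A : Fin m → ℝ → ℝ)
    (I : Fin m → Set ℝ) : Prop where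
  isOpen : ∀ j, IsOpen (I j)
  nonempty : ∀ j, (I j).Nonempty
  ordConnected : ∀ j, (I j).OrdConnected
  segreMu_ne : ∀ x : Fin m → ℝ, (∀ j, x j ∈ I j) → segreMu x (e 0) ≠ 0
  contDiffOn : ∀ j, ContDiffOn ℝ ∞ (A j) (I j)
  profile_ne : ∀ j, ∀ x ∈ I j, A j x ≠ 0

namespace IsSmoothOn

variable {e : Module.Basis (Fin (m + 1)) ℝ (productSegre m)} {A : Fin m → ℝ → ℝ}
  {I : Fin m → Set ℝ} {x : Fin m → ℝ}

theorem isOpen_pi (H : IsSmoothOn e A I) : IsOpen {x : Fin m → ℝ | ∀ j, x j ∈ I j} := by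
  have : {x : Fin m → ℝ | ∀ j, x j ∈ I j} = Set.univ.pi I := by ext; simp
  rw [this]
  exact isOpen_set_pi Set.finite_univ fun j _ => H.isOpen j

theorem contDiffOn_iterate (H : IsSmoothOn e A I) (j : Fin m) (n : ℕ) :
    ContDiffOn ℝ ∞ (deriv^[n] (A j)) (I j) := by
  induction n with
  | zero => exact H.contDiffOn j
  | succ n ih =>
    rw [Function.iterate_succ_apply']
    exact ih.deriv_of_isOpen_infty (H.isOpen j)

theorem hasDerivAt (H : IsSmoothOn e A I) (n : ℕ) (j : Fin m) {s : ℝ} (hs : s ∈ I j) :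
    HasDerivAt (deriv^[n] (A j)) (deriv^[n + 1] (A j) s) s := by
  rw [Function.iterate_succ_apply']
  exact (H.contDiffOn_iterate j n).hasDerivAt_infty (H.isOpen j) s hs

theorem isRegularOn (H : IsSmoothOn e A I) : IsRegularOn e A {x | ∀ j, x j ∈ I j} where
  isOpen := H.isOpen_pi
  segreMu_ne := H.segreMu_ne
  profile_ne x hx j := H.profile_ne j _ (hx j)
  profile_deriv x hx j := H.hasDerivAt 0 j (hx j)
  profile_deriv2 x hx j := H.hasDerivAt 1 j (hx j)

theorem hasPD_iterate (H : IsSmoothOn e A I) (n : ℕ) (hx : ∀ j, x j ∈ I j) (i k : Fin m) :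
    HasPD i (fun y => deriv^[n] (A k) (y k)) (if k = i then deriv^[n + 1] (A k) (x k) else 0) x :=
  hasPD_comp_apply i k (H.hasDerivAt n k (hx k))

theorem exists_mem (H : IsSmoothOn e A I) (i : Fin m) {s : ℝ} (hs : s ∈ I i) :
    ∃ x : Fin m → ℝ, (∀ j, x j ∈ I j) ∧ x i = s := by
  choose y hy using H.nonempty
  refine ⟨Function.update y i s, fun j => ?_, by simp⟩
  by_cases h : j = i
  · subst h; simpa using hs
  · simpa [h] using hy j

/-- Here the geometry ends: what remains is a differential equation for the functions `A_j`. -/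
theorem isExtremal_iff (H : IsSmoothOn e A I) :
    IsExtremal (metric e A) (symplecticForm e) (domain I) ↔
      ∃ η : productSegre m, ∀ x : Fin m → ℝ, (∀ j, x j ∈ I j) →
        extremalDefect e A x = segreMu x η :=
  have h3 : ∀ x ∈ {x : Fin m → ℝ | ∀ j, x j ∈ I j}, ∀ j,
      HasDerivAt (deriv (deriv (A j))) (deriv (deriv (deriv (A j))) (x j)) (x j) :=
    fun x hx j => H.hasDerivAt 2 j (hx j)
  ⟨exists_extremalDefect_eq H.nonempty H.ordConnected H.isRegularOn h3,
    fun ⟨η, hη⟩ => isExtremal_of_extremalDefect_eq H.isRegularOn h3 η hη⟩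

/-! ### Derivatives of the extremality equation -/

section Necessity

variable (H : IsSmoothOn e A I) {η : productSegre m}
  (hη : ∀ x : Fin m → ℝ, (∀ j, x j ∈ I j) → extremalDefect e A x = segreMu x η)

include H hη

theorem pd_extremalDefect (hx : ∀ j, x j ∈ I j) (i : Fin m) :
    2 * segreSlope (e 0) i * segreMu x (e 0) * ∑ k, deriv^[2] (A k) (x k)
      + segreMu x (e 0) ^ 2 * deriv^[3] (A i) (x i)
      - 2 * (m + 1) * segreSlope (e 0) i * ∑ k, segreSlope (e 0) k * deriv^[1] (A k) (x k)
      - 2 * (m + 1) * segreMu x (e 0) * (segreSlope (e 0) i * deriv^[2] (A i) (x i))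
      + (m + 1) * (m + 2) * (segreSlope (e 0) i ^ 2 * deriv^[1] (A i) (x i)) = segreSlope η i :=
  (hasPD_extremalDefect H.isRegularOn (fun x hx j => H.hasDerivAt 2 j (hx j)) hx i).unique_on
    (hasPD_segreMu η i x) H.isOpen_pi hx hη

/-- An affine function has zero Hessian. All necessary conditions on the `A_j` come from these
entries and their derivatives. -/
theorem pd_pd_extremalDefect (hx : ∀ j, x j ∈ I j) (i j : Fin m) :
    2 * segreSlope (e 0) i * segreSlope (e 0) j * ∑ k, deriv^[2] (A k) (x k)
      + 2 * segreMu x (e 0) * (segreSlope (e 0) i * deriv^[3] (A j) (x j)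
        + segreSlope (e 0) j * deriv^[3] (A i) (x i))
      - 2 * (m + 1) * segreSlope (e 0) i * segreSlope (e 0) j *
        (deriv^[2] (A i) (x i) + deriv^[2] (A j) (x j))
      + (if i = j then segreMu x (e 0) ^ 2 * deriv^[4] (A i) (x i)
        - 2 * (m + 1) * segreMu x (e 0) * segreSlope (e 0) i * deriv^[3] (A i) (x i)
        + (m + 1) * (m + 2) * segreSlope (e 0) i ^ 2 * deriv^[2] (A i) (x i) else 0) = 0 := by
  have hf := hasPD_segreMu (e 0) j x
  have hU := hasPD_sum_comp_apply (fun _ => 1) (B' := fun k => deriv^[3] (A k))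
    (fun k => H.hasDerivAt 2 k (hx k)) j
  have hV := hasPD_sum_comp_apply (segreSlope (e 0)) (B' := fun k => deriv^[2] (A k))
    (fun k => H.hasDerivAt 1 k (hx k)) j
  simp only [one_mul] at hU
  have h := (((((hf.const_mul (2 * segreSlope (e 0) i)).mul hU).add
    ((hf.mul hf).mul (H.hasPD_iterate 3 hx j i))).sub
    (hV.const_mul (2 * ((m : ℝ) + 1) * segreSlope (e 0) i))).sub
    ((hf.const_mul (2 * ((m : ℝ) + 1))).mul
      ((H.hasPD_iterate 2 hx j i).const_mul (segreSlope (e 0) i)))).add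
    (((H.hasPD_iterate 1 hx j i).const_mul (segreSlope (e 0) i ^ 2)).const_mul
      (((m : ℝ) + 1) * (m + 2)))
  have h2 := h.unique_on (hasPD_const j (segreSlope η i) x) H.isOpen_pi hx fun y hy => by
    rw [← pd_extremalDefect H hη hy i]; ring
  refine Eq.trans ?_ h2
  split_ifs with hij
  · subst hij; ring
  · ring

theorem iterate_three_eq_zero {i j : Fin m} (hi : segreSlope (e 0) i = 0)
    (hj : segreSlope (e 0) j ≠ 0) {s : ℝ} (hs : s ∈ I i) : deriv^[3] (A i) s = 0 := by
  obtain ⟨x, hx, rfl⟩ := H.exists_mem i hs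
  have hij : i ≠ j := fun h => hj (h ▸ hi)
  have h := pd_pd_extremalDefect H hη hx i j
  rw [if_neg hij, hi] at h
  have hf := H.segreMu_ne x hx
  have : segreMu x (e 0) * segreSlope (e 0) j * deriv^[3] (A i) (x i) = 0 := by linarith
  simpa [hf, hj] using this

theorem iterate_four_eq_zero (h0 : ∀ j, segreSlope (e 0) j = 0) (i : Fin m) {s : ℝ}
    (hs : s ∈ I i) : deriv^[4] (A i) s = 0 := by
  obtain ⟨x, hx, rfl⟩ := H.exists_mem i hs
  have h := pd_pd_extremalDefect H hη hx i i
  rw [if_pos rfl, h0] at h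
  have hf := H.segreMu_ne x hx
  have : segreMu x (e 0) ^ 2 * deriv^[4] (A i) (x i) = 0 := by linarith
  simpa [hf] using this

variable {i j : Fin m} (hij : i ≠ j)

include hij

theorem pair_first (hx : ∀ j, x j ∈ I j) :
    segreSlope (e 0) i * segreSlope (e 0) j * ∑ k, deriv^[2] (A k) (x k)
      + segreMu x (e 0) * (segreSlope (e 0) i * deriv^[3] (A j) (x j)
        + segreSlope (e 0) j * deriv^[3] (A i) (x i))
      - (m + 1) * segreSlope (e 0) i * segreSlope (e 0) j *
        (deriv^[2] (A i) (x i) + deriv^[2] (A j) (x j)) = 0 := by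
  have h := pd_pd_extremalDefect H hη hx i j
  rw [if_neg hij] at h
  linarith

/-- The `x_i`-derivative of `pair_first`. The coefficient `m - 1` is `m + 1` reduced by one for the
sum over `k` and one for `∂_i f`. -/
theorem pair_second (hx : ∀ j, x j ∈ I j) :
    segreMu x (e 0) * segreSlope (e 0) j * deriv^[4] (A i) (x i) =
      (m - 1) * segreSlope (e 0) i * segreSlope (e 0) j * deriv^[3] (A i) (x i)
        - segreSlope (e 0) i ^ 2 * deriv^[3] (A j) (x j) := by
  have hU := hasPD_sum_comp_apply (fun _ => 1) (B' := fun k => deriv^[3] (A k))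
    (fun k => H.hasDerivAt 2 k (hx k)) i
  simp only [one_mul] at hU
  have h := ((hU.const_mul (segreSlope (e 0) i * segreSlope (e 0) j)).add
    ((hasPD_segreMu (e 0) i x).mul (((H.hasPD_iterate 3 hx i j).const_mul (segreSlope (e 0) i)).add
      ((H.hasPD_iterate 3 hx i i).const_mul (segreSlope (e 0) j))))).sub
    (((H.hasPD_iterate 2 hx i i).add (H.hasPD_iterate 2 hx i j)).const_mul
      (((m : ℝ) + 1) * segreSlope (e 0) i * segreSlope (e 0) j))
  have h2 := h.unique_on (hasPD_const i 0 x) H.isOpen_pi hx fun y hy => pair_first H hη hij hy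
  simp only [if_pos, if_neg hij.symm] at h2
  linarith

/-- The `x_j`-derivative of `pair_second`. The variables are now separated: the left side depends on
`x_i` alone and the right side on `x_j` alone. -/
theorem pair_third (hx : ∀ j, x j ∈ I j) :
    segreSlope (e 0) j ^ 2 * deriv^[4] (A i) (x i) =
      -(segreSlope (e 0) i ^ 2 * deriv^[4] (A j) (x j)) := by
  have h := ((hasPD_segreMu (e 0) j x).mul ((H.hasPD_iterate 4 hx j i).const_mul
    (segreSlope (e 0) j))).unique_on
    (((H.hasPD_iterate 3 hx j i).const_mul (((m : ℝ) - 1) * segreSlope (e 0) i *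
      segreSlope (e 0) j)).sub ((H.hasPD_iterate 3 hx j j).const_mul (segreSlope (e 0) i ^ 2)))
    H.isOpen_pi hx fun y hy => by rw [← pair_second H hη hij hy]; ring
  simp only [if_pos, if_neg hij] at h
  linarith

theorem iterate_five_eq_zero (hj : segreSlope (e 0) j ≠ 0) {s : ℝ} (hs : s ∈ I i) :
    deriv^[5] (A i) s = 0 := by
  obtain ⟨x, hx, rfl⟩ := H.exists_mem i hs
  have h := ((H.hasPD_iterate 4 hx i i).const_mul (segreSlope (e 0) j ^ 2)).unique_on
    ((H.hasPD_iterate 4 hx i j).const_mul (segreSlope (e 0) i ^ 2)).neg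
    H.isOpen_pi hx fun y hy => pair_third H hη hij hy
  simp only [if_pos, if_neg hij.symm] at h
  simpa [hj] using h

/-- Adding `b_j` times `pair_second` for `(i, j)` to `b_i` times the one for `(j, i)` cancels the
fourth derivatives by `pair_third`. What is left is `(m - 2) b_i b_j (b_j A_i''' + b_i A_j''') = 0`.
For `m ≠ 2` this separates the variables, so `A_i'''` is constant, and then `pair_second` reads `m
b_i b_j A_i''' = 0`. -/
theorem iterate_three_eq_zero_of_pair (hm : 3 ≤ m) (hi : segreSlope (e 0) i ≠ 0)
    (hj : segreSlope (e 0) j ≠ 0) {s : ℝ} (hs : s ∈ I i) : deriv^[3] (A i) s = 0 := by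
  have h1 : ∀ y : Fin m → ℝ, (∀ j, y j ∈ I j) → segreSlope (e 0) j * deriv^[3] (A i) (y i) =
      -(segreSlope (e 0) i * deriv^[3] (A j) (y j)) := fun y hy => by
    have q1 := pair_second H hη hij hy
    have q1' := pair_second H hη hij.symm hy
    have q2 := pair_third H hη hij hy
    have : ((m : ℝ) - 2) * (segreSlope (e 0) i * segreSlope (e 0) j *
        (segreSlope (e 0) j * deriv^[3] (A i) (y i) +
          segreSlope (e 0) i * deriv^[3] (A j) (y j))) = 0 := by
      linear_combination segreMu y (e 0) * q2 - segreSlope (e 0) j * q1 - segreSlope (e 0) i * q1'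
    have hm2 : (m : ℝ) - 2 ≠ 0 := by
      have : (3 : ℝ) ≤ m := by exact_mod_cast hm
      linarith
    have := (mul_eq_zero.mp this).resolve_left hm2
    have := (mul_eq_zero.mp this).resolve_left (mul_ne_zero hi hj)
    linarith
  obtain ⟨x, hx, rfl⟩ := H.exists_mem i hs
  have h := ((H.hasPD_iterate 3 hx i i).const_mul (segreSlope (e 0) j)).unique_on
    ((H.hasPD_iterate 3 hx i j).const_mul (segreSlope (e 0) i)).neg H.isOpen_pi hx h1
  simp only [if_pos, if_neg hij.symm, mul_zero, neg_zero] at h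
  have h4 := (mul_eq_zero.mp h).resolve_left hj
  have q1 := pair_second H hη hij hx
  rw [show deriv^[4] (A i) (x i) = 0 from h4] at q1
  have h5 : (m : ℝ) * (segreSlope (e 0) i * segreSlope (e 0) j * deriv^[3] (A i) (x i)) = 0 := by
    linear_combination -q1 + segreSlope (e 0) i * h1 x hx
  have hm0 : (m : ℝ) ≠ 0 := by positivity
  simpa [hm0, hi, hj] using h5

/-- Once third derivatives vanish, the Hessian entries `(i, j)`, `(i, i)`, `(j, j)` form a
homogeneous linear system in `u = A_i''`, `v = A_j''` and `w = ∑ A_k''`. Eliminating `u + v` gives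
`(m + 2) w = 0`, after which `(m + 1)(m - 2) u = 0`. -/
theorem iterate_two_eq_zero_of_pair (hm : 3 ≤ m) (hi : segreSlope (e 0) i ≠ 0)
    (hj : segreSlope (e 0) j ≠ 0) (hx : ∀ j, x j ∈ I j) :
    deriv^[2] (A i) (x i) = 0 ∧ ∑ k, deriv^[2] (A k) (x k) = 0 := by
  have z3i : ∀ s ∈ I i, deriv^[3] (A i) s = 0 := fun s hs =>
    iterate_three_eq_zero_of_pair H hη hij hm hi hj hs
  have z3j : ∀ s ∈ I j, deriv^[3] (A j) s = 0 := fun s hs =>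
    iterate_three_eq_zero_of_pair H hη hij.symm hm hj hi hs
  have z4 : ∀ k, (∀ s ∈ I k, deriv^[3] (A k) s = 0) → deriv^[4] (A k) (x k) = 0 := fun k hk => by
    have := deriv_eq_of_eqOn (H.isOpen k) (f' := fun _ => 0) hk
      (fun s _ => hasDerivAt_const s 0) (x k) (hx k)
    exact this
  have p1 := pair_first H hη hij hx
  have pi := pd_pd_extremalDefect H hη hx i i
  have pj := pd_pd_extremalDefect H hη hx j j
  rw [if_pos rfl] at pi pj
  rw [z3i _ (hx i), z4 i z3i] at pi
  rw [z3j _ (hx j), z4 j z3j] at pj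
  rw [z3i _ (hx i), z3j _ (hx j)] at p1
  set u := deriv^[2] (A i) (x i)
  set v := deriv^[2] (A j) (x j)
  set w := ∑ k, deriv^[2] (A k) (x k)
  have hm3 : (3 : ℝ) ≤ m := by exact_mod_cast hm
  have e1 : w = (m + 1) * (u + v) := by
    have : segreSlope (e 0) i * segreSlope (e 0) j * (w - (m + 1) * (u + v)) = 0 := by
      linear_combination p1
    have := (mul_eq_zero.mp this).resolve_left (mul_ne_zero hi hj)
    linarith
  have e2 : 2 * w + (m + 1) * (m - 2) * u = 0 := by
    have : segreSlope (e 0) i ^ 2 * (2 * w + (m + 1) * (m - 2) * u) = 0 := by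
      linear_combination pi
    exact (mul_eq_zero.mp this).resolve_left (pow_ne_zero 2 hi)
  have e3 : 2 * w + (m + 1) * (m - 2) * v = 0 := by
    have : segreSlope (e 0) j ^ 2 * (2 * w + (m + 1) * (m - 2) * v) = 0 := by
      linear_combination pj
    exact (mul_eq_zero.mp this).resolve_left (pow_ne_zero 2 hj)
  have hw : ((m : ℝ) + 2) * w = 0 := by
    linear_combination e2 + e3 + (m - 2 : ℝ) * e1
  have hw0 : w = 0 := (mul_eq_zero.mp hw).resolve_left (by positivity)
  rw [hw0] at e2
  refine ⟨?_, hw0⟩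
  have : ((m : ℝ) + 1) * (m - 2) ≠ 0 := mul_ne_zero (by positivity) (by linarith)
  have e4 : ((m : ℝ) + 1) * (m - 2) * u = 0 := by linarith
  exact (mul_eq_zero.mp e4).resolve_left this

end Necessity

end IsSmoothOn
end TwistedProduct

/-! ### The tensor `β` in terms of its slopes -/

section Segre

variable {m : ℕ}

theorem segreMu_of_coe_eq_sum {η : productSegre m} {S : Finset (Fin m)} {a b : Fin m → ℝ}
    (h : (η : SegreTensor m) = ∑ j ∈ S, segreIns j ![a j, b j]) :
    segreMu 0 η = ∑ j ∈ S, a j ∧ ∀ k, segreSlope η k = if k ∈ S then b k else 0 := by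
  have h1 := (coe_eq_sum_segreIns_iff η S a b).mp h
  refine ⟨by simpa using h1 0, fun k => ?_⟩
  simp [segreSlope, h1, Pi.single_apply]

theorem exists_coe_eq_sum {η : productSegre m} {S : Finset (Fin m)} (hS : S.Nonempty)
    (h : ∀ k ∉ S, segreSlope η k = 0) :
    ∃ a : Fin m → ℝ, (η : SegreTensor m) = ∑ j ∈ S, segreIns j ![a j, segreSlope η j] ∧
      ∑ j ∈ S, a j = segreMu 0 η := by
  obtain ⟨j, hj⟩ := hS
  have h1 : ∑ k ∈ S, Pi.single (M := fun _ => ℝ) j (segreMu 0 η) k = segreMu 0 η := by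
    simp [Pi.single_apply, hj]
  -- Only the sum of the `a_k` over `S` is determined by `η`; here one slot carries all of it.
  refine ⟨Pi.single j (segreMu 0 η), (coe_eq_sum_segreIns_iff _ _ _ _).mpr fun x => ?_, h1⟩
  rw [segreMu_eq, h1, ← Finset.sum_subset (Finset.subset_univ S)]
  intro k _ hk
  rw [h k hk, zero_mul]

theorem segreMu_of_coe_eq_segreIns {η : productSegre m} {j : Fin m} {a b : ℝ}
    (h : (η : SegreTensor m) = segreIns j ![a, b]) :
    (∀ x, segreMu x η = a + b * x j) ∧ ∀ k, segreSlope η k = if k = j then b else 0 := by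
  have h1 := (coe_eq_sum_segreIns_iff η {j} (fun _ => a) (fun _ => b)).mp (by simpa using h)
  have h2 := (segreMu_of_coe_eq_sum (S := {j}) (a := fun _ => a) (b := fun _ => b)
    (by simpa using h)).2
  exact ⟨by simpa using h1, by simpa using h2⟩

end Segre

theorem IsDoubleIntegralOn.congr {F f g : ℝ → ℝ} {I : Set ℝ} (h : IsDoubleIntegralOn F f I)
    (e : ∀ x ∈ I, f x = g x) : IsDoubleIntegralOn F g I := by
  obtain ⟨G, hG, hG'⟩ := h
  exact ⟨G, hG, fun x hx => e x hx ▸ hG' x hx⟩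

/-! ### Solutions according to the number of variables in `⟨μ, β⟩` -/

namespace TwistedProduct

open Chart

namespace IsSmoothOn

variable {m : ℕ} {e : Module.Basis (Fin (m + 1)) ℝ (productSegre m)} {A : Fin m → ℝ → ℝ}
  {I : Fin m → Set ℝ} {η : productSegre m}

theorem isPolynomialOn (H : IsSmoothOn e A I) (j : Fin m) (d : ℕ)
    (h : ∀ s ∈ I j, deriv^[d + 1] (A j) s = 0) : IsPolynomialOn d (A j) (I j) :=
  isPolynomialOn_of_iterate_deriv (H.isOpen j) (H.ordConnected j) d _ (H.contDiffOn j) h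

theorem exists_extremalDefect_of_const (H : IsSmoothOn e A I) (hm : 0 < m)
    (h0 : ∀ k, segreSlope (e 0) k = 0) (hA : ∀ i, IsPolynomialOn 3 (A i) (I i)) :
    ∃ η : productSegre m, ∀ x : Fin m → ℝ, (∀ j, x j ∈ I j) →
      extremalDefect e A x = segreMu x η := by
  choose c hc using fun i => (hA i).exists_coeff
  obtain ⟨η, hη⟩ := exists_segreMu_eq hm (segreMu 0 (e 0) ^ 2 * ∑ k, 2 * c k 2)
    (fun k => segreMu 0 (e 0) ^ 2 * (6 * c k 3))
  refine ⟨η, fun x hx => ?_⟩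
  have h2 : ∀ k, deriv (deriv (A k)) (x k) = 2 * c k 2 + 6 * c k 3 * x k := fun k => by
    rw [deriv_eq_of_eq_sum_pow (H.isOpen k) (deriv_eq_of_eq_sum_pow (H.isOpen k) (hc k)) _ (hx k)]
    simp [Finset.sum_range_succ]; ring
  rw [hη, extremalDefect, segreMu_eq x (e 0)]
  simp only [h0, h2, zero_mul, Finset.sum_const_zero, add_zero, mul_zero, sub_zero,
    ne_eq, OfNat.ofNat_ne_zero, not_false_eq_true, zero_pow, Finset.sum_add_distrib, mul_add,
    Finset.mul_sum]
  congr 1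
  exact Finset.sum_congr rfl fun k _ => by ring

section OneVariableTwist

variable {j : Fin m} {a b : ℝ}

theorem extremalDefect_eq_twistOperator (hβ : ((e 0 : productSegre m) : SegreTensor m) =
    segreIns j ![a, b]) (x : Fin m → ℝ) :
    extremalDefect e A x = (a + b * x j) ^ 2 * ∑ i ∈ Finset.univ.erase j, deriv (deriv (A i)) (x i)
      + twistOperator m a b (A j) (x j) := by
  obtain ⟨h1, h2⟩ := segreMu_of_coe_eq_segreIns hβ
  rw [extremalDefect, h1, ← Finset.add_sum_erase _ _ (Finset.mem_univ j), twistOperator]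
  simp [h2]
  ring

theorem affine_ne (H : IsSmoothOn e A I) (hβ : ((e 0 : productSegre m) : SegreTensor m) =
    segreIns j ![a, b]) : ∀ s ∈ I j, a + b * s ≠ 0 := fun s hs => by
  obtain ⟨x, hx, rfl⟩ := H.exists_mem j hs
  rw [← (segreMu_of_coe_eq_segreIns hβ).1]
  exact H.segreMu_ne x hx

/-- For `i ≠ j` the functions `A_i''` are constant, with sum `σ`, and `η` has no slope in direction
`i`. So the twist operator applied to `A_j` is an affine function of `x_j` minus `σ (a + b x_j)²`.
-/
theorem exists_oneVariableTwistSolution (H : IsSmoothOn e A I) (hb : b ≠ 0)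
    (hβ : ((e 0 : productSegre m) : SegreTensor m) = segreIns j ![a, b])
    (hη : ∀ x : Fin m → ℝ, (∀ j, x j ∈ I j) → extremalDefect e A x = segreMu x η) :
    ∃ γ : Fin 3 → ℝ, OneVariableTwistSolution I A j a b γ := by
  obtain ⟨h1, h2⟩ := segreMu_of_coe_eq_segreIns hβ
  have hj : segreSlope (e 0) j ≠ 0 := by simpa [h2] using hb
  have z3 : ∀ i, i ≠ j → ∀ s ∈ I i, deriv^[3] (A i) s = 0 := fun i hi s hs =>
    iterate_three_eq_zero H hη (by simp [h2, hi]) hj hs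
  have hs : ∀ i, i ≠ j → segreSlope η i = 0 := fun i hi => by
    choose y hy using H.nonempty
    rw [← pd_extremalDefect H hη hy i, z3 i hi _ (hy i)]
    simp [h2, hi]
  choose y hy using H.nonempty
  set σ := ∑ i ∈ Finset.univ.erase j, deriv^[2] (A i) (y i) with hσ
  have hc : ∀ x : Fin m → ℝ, (∀ i, x i ∈ I i) →
      ∑ i ∈ Finset.univ.erase j, deriv (deriv (A i)) (x i) = σ := fun x hx => by
    refine Finset.sum_congr rfl fun i hi => ?_
    exact eq_of_hasDerivAt_zero (H.isOpen i) (H.ordConnected i) (f := deriv^[2] (A i))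
      (fun s hs => (H.hasDerivAt 2 i hs).congr_deriv (z3 i (Finset.ne_of_mem_erase hi) s hs))
      (hx i) (hy i)
  have hT : ∀ s ∈ I j, twistOperator m a b (A j) s =
      segreMu 0 η + segreSlope η j * s - (a + b * s) ^ 2 * σ := fun s hs' => by
    obtain ⟨x, hx, rfl⟩ := H.exists_mem j hs'
    have h3 := hη x hx
    rw [extremalDefect_eq_twistOperator hβ, hc x hx, segreMu_eq x η,
      Finset.sum_eq_single j (fun i _ hi => by rw [hs i hi, zero_mul]) (by simp)] at h3
    linarith
  have h0 := H.affine_ne hβ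
  -- These are the coefficients of that quadratic polynomial; the last one is the required relation
  -- with `σ`.
  refine ⟨![segreMu 0 η - a ^ 2 * σ, segreSlope η j - 2 * a * b * σ, -(b ^ 2 * σ)],
    ⟨_, (isDoubleIntegralOn_div (H.isOpen j) (H.contDiffOn j) m h0).congr fun s hs' => ?_,
      fun s hs' => ?_⟩, fun i hi => ?_, fun x hx => ?_⟩
  · rw [hT s hs']
    simp [Fin.sum_univ_three]
    ring
  · rw [mul_div_cancel₀ _ (pow_ne_zero _ (h0 s hs'))]
  · exact H.isPolynomialOn i 2 (z3 i hi)
  · rw [hc x hx]; simp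

theorem exists_extremalDefect_of_oneVariableTwistSolution (H : IsSmoothOn e A I) (hb : b ≠ 0)
    (hβ : ((e 0 : productSegre m) : SegreTensor m) = segreIns j ![a, b]) {γ : Fin 3 → ℝ}
    (h : OneVariableTwistSolution I A j a b γ) :
    ∃ η : productSegre m, ∀ x : Fin m → ℝ, (∀ j, x j ∈ I j) →
      extremalDefect e A x = segreMu x η := by
  obtain ⟨⟨F, hF, hA⟩, -, hγ⟩ := h
  have hT := twistOperator_eq_of_isDoubleIntegralOn (H.isOpen j) (H.contDiffOn j) m
    (H.affine_ne hβ) hF hA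
  -- The affine function `Υ - (γ₂ / b²)(a + b x_j)²`: the condition on the `A_i''` removes the
  -- quadratic term.
  obtain ⟨η, hη⟩ := exists_segreMu_eq (Fin.pos j) (γ 0 - a ^ 2 * (γ 2 / b ^ 2))
    (Pi.single j (γ 1 - 2 * a * b * (γ 2 / b ^ 2)))
  refine ⟨η, fun x hx => ?_⟩
  have h1 : ∑ i ∈ Finset.univ.erase j, deriv (deriv (A i)) (x i) = -(γ 2 / b ^ 2) := by
    have := hγ x hx
    field_simp
    linarith
  rw [extremalDefect_eq_twistOperator hβ, hT _ (hx j), h1, hη]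
  simp only [Fin.sum_univ_three, Pi.single_apply, ite_mul, zero_mul, Finset.sum_ite_eq',
    Finset.mem_univ, if_true, Fin.val_zero, Fin.val_one, Fin.val_two]
  field_simp
  ring

theorem exists_explicit (H : IsSmoothOn e A I) (hm : 2 ≤ m) (hb : b ≠ 0)
    (hβ : ((e 0 : productSegre m) : SegreTensor m) = segreIns j ![a, b]) {γ : Fin 3 → ℝ}
    (h : OneVariableTwistSolution I A j a b γ) :
    ∃ (q : Polynomial ℝ) (ν₀ ν₁ : ℝ), q.natDegree ≤ 2 ∧
      ∀ x ∈ I j, A j x = q.eval x + (a + b * x) ^ (m + 1) * (ν₀ + ν₁ * x) := by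
  obtain ⟨⟨F, hF, hA⟩, -, -⟩ := h
  exact exists_explicit_of_isDoubleIntegralOn (H.isOpen j) (H.ordConnected j) hm hb
    (H.affine_ne hβ) (γ 0) (γ 1) (γ 2)
    (hF.congr fun x _ => by simp [Fin.sum_univ_three]) hA

end OneVariableTwist

theorem isPolynomialOn_of_pair (H : IsSmoothOn e A I) (hm : 3 ≤ m) {S : Finset (Fin m)}
    (hS : 2 ≤ S.card) (hS' : ∀ k, k ∈ S ↔ segreSlope (e 0) k ≠ 0)
    (hη : ∀ x : Fin m → ℝ, (∀ j, x j ∈ I j) → extremalDefect e A x = segreMu x η) :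
    (∀ j ∈ S, IsPolynomialOn 1 (A j) (I j)) ∧ (∀ r ∉ S, IsPolynomialOn 2 (A r) (I r)) ∧
      ∀ x : Fin m → ℝ, (∀ i, x i ∈ I i) → ∑ r ∈ Sᶜ, deriv (deriv (A r)) (x r) = 0 := by
  have h2 : ∀ i ∈ S, ∀ x : Fin m → ℝ, (∀ i, x i ∈ I i) →
      deriv^[2] (A i) (x i) = 0 ∧ ∑ k, deriv^[2] (A k) (x k) = 0 := fun i hi x hx => by
    obtain ⟨j, hj, hji⟩ := Finset.exists_mem_ne (by omega : 1 < S.card) i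
    exact iterate_two_eq_zero_of_pair H hη hji.symm hm ((hS' i).mp hi) ((hS' j).mp hj) hx
  obtain ⟨j, hj⟩ : S.Nonempty := Finset.card_pos.mp (by omega)
  refine ⟨fun i hi => H.isPolynomialOn i 1 fun s hs => ?_, fun r hr => H.isPolynomialOn r 2
    fun s hs => iterate_three_eq_zero H hη (not_not.mp fun h => hr ((hS' r).mpr h))
      ((hS' j).mp hj) hs, fun x hx => ?_⟩
  · obtain ⟨x, hx, rfl⟩ := H.exists_mem i hs
    exact (h2 i hi x hx).1
  · have h3 := (h2 j hj x hx).2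
    rw [← Finset.sum_add_sum_compl S, Finset.sum_eq_zero fun i hi => (h2 i hi x hx).1,
      zero_add] at h3
    exact h3

/-- The hypotheses give `∑ A_k'' = 0`, so the defect is a constant multiple of `f` plus a
combination of the affine functions `A_k`, `k ∈ S`. -/
theorem exists_extremalDefect_of_pair (H : IsSmoothOn e A I) (hm : 0 < m) {S : Finset (Fin m)}
    (hS : ∀ k ∉ S, segreSlope (e 0) k = 0)
    (hA : ∀ j ∈ S, IsPolynomialOn 1 (A j) (I j))
    (hsum : ∀ x : Fin m → ℝ, (∀ i, x i ∈ I i) → ∑ r ∈ Sᶜ, deriv (deriv (A r)) (x r) = 0) :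
    ∃ η : productSegre m, ∀ x : Fin m → ℝ, (∀ j, x j ∈ I j) →
      extremalDefect e A x = segreMu x η := by
  -- Outside `S` the coefficients are arbitrary, which is harmless because they are always
  -- multiplied by a zero slope.
  choose! c hc using fun j hj => (hA j hj).exists_coeff
  set b := segreSlope (e 0) with hb
  obtain ⟨ζ, hζ⟩ := exists_segreMu_eq hm
    ((m + 1) * (m + 2) * ∑ k, b k ^ 2 * c k 0) (fun k => (m + 1) * (m + 2) * (b k ^ 2 * c k 1))
  refine ⟨(-(2 * (m + 1) * ∑ k, b k * c k 1)) • e 0 + ζ, fun x hx => ?_⟩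
  have d1 : ∀ k ∈ S, ∀ s ∈ I k, deriv (A k) s = ∑ k_1 ∈ Finset.range 1,
    (k_1 + 1) * c k (k_1 + 1) * s ^ k_1 := fun k hk => deriv_eq_of_eq_sum_pow (H.isOpen k) (hc k hk)
  have d2 : ∀ k ∈ S, deriv (deriv (A k)) (x k) = 0 := fun k hk => by
    rw [deriv_eq_of_eq_sum_pow (H.isOpen k) (d1 k hk) _ (hx k)]; simp
  have e2 : ∑ k, deriv (deriv (A k)) (x k) = 0 := by
    rw [← Finset.sum_add_sum_compl S, Finset.sum_eq_zero d2, hsum x hx, add_zero]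
  have e1 : ∀ k, b k * deriv (A k) (x k) = b k * c k 1 := fun k => by
    by_cases hk : k ∈ S
    · rw [d1 k hk _ (hx k)]; simp
    · rw [hS k hk, zero_mul, zero_mul]
  have e0 : ∀ k, b k ^ 2 * A k (x k) = b k ^ 2 * (c k 0 + c k 1 * x k) := fun k => by
    by_cases hk : k ∈ S
    · rw [hc k hk _ (hx k)]; simp [Finset.sum_range_succ]
    · rw [hS k hk]; simp
  have e0' : ∑ k, segreSlope (e 0) k ^ 2 * A k (x k) =
      ∑ k, b k ^ 2 * c k 0 + ∑ k, b k ^ 2 * (c k 1 * x k) := by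
    simp only [← hb, e0, mul_add, Finset.sum_add_distrib]
  have e1' : ∑ k, segreSlope (e 0) k * deriv (A k) (x k) = ∑ k, b k * c k 1 := by
    simp only [← hb, e1]
  have w : ∑ k, ((m : ℝ) + 1) * (m + 2) * (b k ^ 2 * c k 1) * x k =
      (m + 1) * (m + 2) * ∑ k, b k ^ 2 * (c k 1 * x k) := by
    rw [Finset.mul_sum]
    exact Finset.sum_congr rfl fun k _ => by ring
  rw [extremalDefect, e2, e1', e0', map_add, map_smul, hζ, w, smul_eq_mul]
  ring

end IsSmoothOn

/-! ### The quartic solutions for `m = 2` -/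

namespace IsSmoothOn

variable {e : Module.Basis (Fin (2 + 1)) ℝ (productSegre 2)} {A : Fin 2 → ℝ → ℝ}
  {I : Fin 2 → Set ℝ} {η : productSegre 2}

/-- For quartics, the three pair relations at a single point are triangular: `pair_third` gives `c
4`, then `pair_second` gives `c 3`, then `pair_first` gives `c 2`, and the coordinates of the point
drop out. -/
theorem exists_coeff_of_two (H : IsSmoothOn e A I)
    (hη : ∀ x : Fin 2 → ℝ, (∀ j, x j ∈ I j) → extremalDefect e A x = segreMu x η)
    (h0 : segreSlope (e 0) 0 ≠ 0) (h1 : segreSlope (e 0) 1 ≠ 0) :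
    ∃ a c : ℕ → ℝ, (∀ x ∈ I 0, A 0 x = ∑ r ∈ Finset.range (4 + 1), a r * x ^ r) ∧
      (∀ x ∈ I 1, A 1 x = ∑ r ∈ Finset.range (4 + 1), c r * x ^ r) ∧
      c 4 = -(segreSlope (e 0) 1 ^ 2 / segreSlope (e 0) 0 ^ 2) * a 4 ∧
      c 3 = -4 * (segreMu 0 (e 0) * segreSlope (e 0) 1 / segreSlope (e 0) 0 ^ 2) * a 4
        + segreSlope (e 0) 1 / segreSlope (e 0) 0 * a 3 ∧
      c 2 = -6 * (segreMu 0 (e 0) ^ 2 / segreSlope (e 0) 0 ^ 2) * a 4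
        + 3 * (segreMu 0 (e 0) / segreSlope (e 0) 0) * a 3 - a 2 := by
  obtain ⟨a, ha⟩ := (H.isPolynomialOn 0 4 fun s hs =>
    iterate_five_eq_zero H hη (zero_ne_one) h1 hs).exists_coeff
  obtain ⟨c, hc⟩ := (H.isPolynomialOn 1 4 fun s hs =>
    iterate_five_eq_zero H hη (one_ne_zero) h0 hs).exists_coeff
  refine ⟨a, c, ha, hc, ?_⟩
  have a1 := deriv_eq_of_eq_sum_pow (H.isOpen 0) ha
  have a2 := deriv_eq_of_eq_sum_pow (H.isOpen 0) a1
  have a3 := deriv_eq_of_eq_sum_pow (H.isOpen 0) a2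
  have a4 := deriv_eq_of_eq_sum_pow (H.isOpen 0) a3
  have c1 := deriv_eq_of_eq_sum_pow (H.isOpen 1) hc
  have c2 := deriv_eq_of_eq_sum_pow (H.isOpen 1) c1
  have c3 := deriv_eq_of_eq_sum_pow (H.isOpen 1) c2
  have c4 := deriv_eq_of_eq_sum_pow (H.isOpen 1) c3
  choose x hx using H.nonempty
  have p1 := pair_first H hη zero_ne_one hx
  have p2 := pair_second H hη zero_ne_one hx
  have p3 := pair_third H hη zero_ne_one hx
  have f0 := segreMu_eq x (e 0)
  rw [Fin.sum_univ_two] at p1 f0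
  simp only [Function.iterate_succ, Function.iterate_zero, Function.comp_apply, id] at p1 p2 p3
  rw [a2 _ (hx 0), a3 _ (hx 0), c2 _ (hx 1), c3 _ (hx 1), f0] at p1
  rw [a3 _ (hx 0), a4 _ (hx 0), c3 _ (hx 1), f0] at p2
  rw [a4 _ (hx 0), c4 _ (hx 1)] at p3
  simp only [Finset.sum_range_succ, Finset.range_zero, Finset.sum_empty] at p1 p2 p3
  push_cast at p1 p2 p3
  norm_num at p1 p2 p3
  set b₀ := segreMu 0 (e 0)
  set b₁ := segreSlope (e 0) 0
  set b₂ := segreSlope (e 0) 1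
  set s := x 0
  set t := x 1
  -- Rescaling `a 4` and `a 3` makes the relations polynomial in `b₀`, `b₁`, `b₂`.
  obtain ⟨u, hu⟩ : ∃ u, a 4 = b₁ ^ 2 * u := ⟨a 4 / b₁ ^ 2, by field_simp⟩
  obtain ⟨v, hv⟩ : ∃ v, a 3 = b₁ * v := ⟨a 3 / b₁, by field_simp⟩
  rw [hu] at p1 p2 p3
  rw [hv] at p1 p2
  have k4 : c 4 = -(b₂ ^ 2 * u) := by
    have : b₁ ^ 2 * (c 4 + b₂ ^ 2 * u) = 0 := by linear_combination (1 / 24 : ℝ) * p3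
    have := (mul_eq_zero.mp this).resolve_left (pow_ne_zero 2 h0)
    linarith
  rw [k4] at p1 p2
  have k3 : c 3 = -4 * b₀ * b₂ * u + b₂ * v := by
    have : b₁ ^ 2 * (c 3 - (-4 * b₀ * b₂ * u + b₂ * v)) = 0 := by
      linear_combination (1 / 6 : ℝ) * p2
    have := (mul_eq_zero.mp this).resolve_left (pow_ne_zero 2 h0)
    linarith
  rw [k3] at p1
  have k2 : c 2 = -6 * b₀ ^ 2 * u + 3 * b₀ * v - a 2 := by
    have : b₁ * b₂ * (c 2 - (-6 * b₀ ^ 2 * u + 3 * b₀ * v - a 2)) = 0 := by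
      linear_combination -(1 / 4 : ℝ) * p1
    have := (mul_eq_zero.mp this).resolve_left (mul_ne_zero h0 h1)
    linarith
  rw [k4, k3, k2, hu, hv]
  refine ⟨?_, ?_, ?_⟩ <;> field_simp

theorem exists_extremalDefect_of_two (H : IsSmoothOn e A I) (h0 : segreSlope (e 0) 0 ≠ 0)
    {a c : ℕ → ℝ} (ha : ∀ x ∈ I 0, A 0 x = ∑ r ∈ Finset.range (4 + 1), a r * x ^ r)
    (hc : ∀ x ∈ I 1, A 1 x = ∑ r ∈ Finset.range (4 + 1), c r * x ^ r)
    (k4 : c 4 = -(segreSlope (e 0) 1 ^ 2 / segreSlope (e 0) 0 ^ 2) * a 4)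
    (k3 : c 3 = -4 * (segreMu 0 (e 0) * segreSlope (e 0) 1 / segreSlope (e 0) 0 ^ 2) * a 4
      + segreSlope (e 0) 1 / segreSlope (e 0) 0 * a 3)
    (k2 : c 2 = -6 * (segreMu 0 (e 0) ^ 2 / segreSlope (e 0) 0 ^ 2) * a 4
      + 3 * (segreMu 0 (e 0) / segreSlope (e 0) 0) * a 3 - a 2) :
    ∃ η : productSegre 2, ∀ x : Fin 2 → ℝ, (∀ j, x j ∈ I j) →
      extremalDefect e A x = segreMu x η := by
  have a1 := deriv_eq_of_eq_sum_pow (H.isOpen 0) ha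
  have a2 := deriv_eq_of_eq_sum_pow (H.isOpen 0) a1
  have c1 := deriv_eq_of_eq_sum_pow (H.isOpen 1) hc
  have c2 := deriv_eq_of_eq_sum_pow (H.isOpen 1) c1
  set b₀ := segreMu 0 (e 0) with hb₀
  set b₁ := segreSlope (e 0) 0 with hb₁
  set b₂ := segreSlope (e 0) 1 with hb₂
  -- The constant and linear terms of the defect; the three relations make all terms of higher
  -- degree vanish.
  obtain ⟨η, hη⟩ := exists_segreMu_eq two_pos
    (b₀ ^ 2 * (2 * a 2 + 2 * c 2) - 6 * b₀ * (b₁ * a 1 + b₂ * c 1)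
      + 12 * (b₁ ^ 2 * a 0 + b₂ ^ 2 * c 0))
    ![6 * b₀ ^ 2 * a 3 - 8 * b₀ * b₁ * a 2 + 4 * b₀ * b₁ * c 2 + 6 * b₁ ^ 2 * a 1 - 6 * b₁ * b₂ * c 1,
      6 * b₀ ^ 2 * c 3 - 8 * b₀ * b₂ * c 2 + 4 * b₀ * b₂ * a 2 + 6 * b₂ ^ 2 * c 1 - 6 * b₁ * b₂ * a 1]
  refine ⟨η, fun x hx => ?_⟩
  obtain ⟨u, hu⟩ : ∃ u, a 4 = b₁ ^ 2 * u := ⟨a 4 / b₁ ^ 2, by field_simp⟩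
  obtain ⟨v, hv⟩ : ∃ v, a 3 = b₁ * v := ⟨a 3 / b₁, by field_simp⟩
  have l4 : c 4 = -(b₂ ^ 2 * u) := by rw [k4, hu]; field_simp
  have l3 : c 3 = -4 * b₀ * b₂ * u + b₂ * v := by rw [k3, hu, hv]; field_simp
  have l2 : c 2 = -6 * b₀ ^ 2 * u + 3 * b₀ * v - a 2 := by rw [k2, hu, hv]; field_simp
  rw [hη, extremalDefect, segreMu_eq x (e 0)]
  simp only [Fin.sum_univ_two, ← hb₀, ← hb₁, ← hb₂, ha _ (hx 0), hc _ (hx 1), a1 _ (hx 0), a2 _ (hx 0),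
    c1 _ (hx 1), c2 _ (hx 1), Finset.sum_range_succ, Finset.range_zero, Finset.sum_empty,
    Matrix.cons_val_zero, Matrix.cons_val_one]
  push_cast
  norm_num
  rw [l4, l3, l2, hu, hv]
  ring

end IsSmoothOn
end TwistedProduct

/-! ### The classification -/

namespace TwistedProduct

namespace IsSmoothOn

variable {m : ℕ} {e : Module.Basis (Fin (m + 1)) ℝ (productSegre m)} {A : Fin m → ℝ → ℝ}
  {I : Fin m → Set ℝ} {η : productSegre m}

/-- The possible solutions of the extremality equation. -/
theorem classification_of_extremalDefect_eq (H : IsSmoothOn e A I) (h0 : 0 < m) (h1 : 1 < m)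
    (hη : ∀ x : Fin m → ℝ, (∀ j, x j ∈ I j) → extremalDefect e A x = segreMu x η) :
    ((∃ t : ℝ, t ≠ 0 ∧ ((e 0 : productSegre m) : SegreTensor m) =
          t • PiTensorProduct.tprod ℝ (fun _ => ![1, 0])) ∧
        ∀ i, IsPolynomialOn 3 (A i) (I i)) ∨
      (∃ (j : Fin m) (a b : ℝ), b ≠ 0 ∧
        ((e 0 : productSegre m) : SegreTensor m) = segreIns j ![a, b] ∧
        ∃ γ : Fin 3 → ℝ, OneVariableTwistSolution I A j a b γ) ∨
      (∃ (S : Finset (Fin m)) (a b : Fin m → ℝ), 2 ≤ S.card ∧ (∀ j ∈ S, b j ≠ 0) ∧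
        ((e 0 : productSegre m) : SegreTensor m) = ∑ j ∈ S, segreIns j ![a j, b j] ∧
        ((m = 2 ∧ ∃ (a₁ a₂ : Fin 5 → ℝ) (β₀ β₁ β₂ : ℝ),
            β₀ = ∑ j ∈ S, a j ∧ β₁ = b ⟨0, h0⟩ ∧ β₂ = b ⟨1, h1⟩ ∧
            (∀ x ∈ I ⟨0, h0⟩, A ⟨0, h0⟩ x = ∑ r : Fin 5, a₁ r * x ^ (r : ℕ)) ∧
            (∀ x ∈ I ⟨1, h1⟩, A ⟨1, h1⟩ x = ∑ r : Fin 5, a₂ r * x ^ (r : ℕ)) ∧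
            a₂ 4 = -(β₂ ^ 2 / β₁ ^ 2) * a₁ 4 ∧
            a₂ 3 = -4 * (β₀ * β₂ / β₁ ^ 2) * a₁ 4 + β₂ / β₁ * a₁ 3 ∧
            a₂ 2 = -6 * (β₀ ^ 2 / β₁ ^ 2) * a₁ 4 + 3 * (β₀ / β₁) * a₁ 3 - a₁ 2) ∨
          (3 ≤ m ∧ (∀ j ∈ S, IsPolynomialOn 1 (A j) (I j)) ∧
            (∀ r ∉ S, IsPolynomialOn 2 (A r) (I r)) ∧
            ∀ x : Fin m → ℝ, (∀ i, x i ∈ I i) →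
              ∑ r ∈ Sᶜ, deriv (deriv (A r)) (x r) = 0))) := by
  -- `S` is the set of variables on which `⟨μ, β⟩` depends; its cardinality (0, 1, or at least 2)
  -- selects the case.
  set S : Finset (Fin m) := Finset.univ.filter fun k => segreSlope (e 0) k ≠ 0 with hS
  have hmem : ∀ k, k ∈ S ↔ segreSlope (e 0) k ≠ 0 := fun k => by simp [hS]
  have hnot : ∀ k ∉ S, segreSlope (e 0) k = 0 := fun k hk =>
    not_not.mp fun h => hk ((hmem k).mpr h)
  rcases lt_or_ge S.card 2 with h2 | h2
  · rcases Nat.lt_succ_iff_lt_or_eq.mp h2 with hS1 | hS1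
    · left
      have hempty : S = ∅ := Finset.card_eq_zero.mp (by omega)
      have hs0 : ∀ k, segreSlope (e 0) k = 0 := fun k => hnot k (by simp [hempty])
      have ht : ∀ x, segreMu x (e 0) = segreMu 0 (e 0) := fun x => by
        rw [segreMu_eq]; simp [hs0]
      choose x hx using H.nonempty
      exact ⟨⟨segreMu 0 (e 0), by rw [← ht x]; exact H.segreMu_ne x hx,
        (coe_eq_smul_tprod_iff h0 _ _).mpr ht⟩,
        fun i => H.isPolynomialOn i 3 fun s hs => iterate_four_eq_zero H hη hs0 i hs⟩
    · right; left
      obtain ⟨j, hj⟩ := Finset.card_eq_one.mp hS1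
      have hne : S.Nonempty := ⟨j, by simp [hj]⟩
      obtain ⟨a, ha, -⟩ := exists_coe_eq_sum hne hnot
      rw [hj, Finset.sum_singleton] at ha
      have hb : segreSlope (e 0) j ≠ 0 := (hmem j).mp (by simp [hj])
      exact ⟨j, a j, segreSlope (e 0) j, hb, ha, H.exists_oneVariableTwistSolution hb ha hη⟩
  · right; right
    obtain ⟨a, ha, ha0⟩ := exists_coe_eq_sum (Finset.card_pos.mp (by omega)) hnot
    refine ⟨S, a, segreSlope (e 0), h2, fun j hj => (hmem j).mp hj, ha, ?_⟩
    rcases Nat.lt_or_ge 2 m with hm3 | hm2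
    · exact Or.inr ⟨hm3, H.isPolynomialOn_of_pair hm3 h2 hmem hη⟩
    · left
      obtain rfl : m = 2 := by omega
      have hu : S = Finset.univ := Finset.eq_univ_of_card S
        (le_antisymm (Finset.card_le_univ S) (by simpa using h2))
      obtain ⟨c, d, hc, hd, k4, k3, k2⟩ := H.exists_coeff_of_two hη
        ((hmem 0).mp (by simp [hu])) ((hmem 1).mp (by simp [hu]))
      refine ⟨rfl, fun r => c r, fun r => d r, segreMu 0 (e 0), _, _, ha0.symm, rfl, rfl,
        fun x hx => (hc x hx).trans (Finset.sum_range _),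
        fun x hx => (hd x hx).trans (Finset.sum_range _), k4, k3, k2⟩

/-- The quartic solutions in dimension two solve the extremality equation. -/
theorem exists_extremalDefect_of_coeff_two {e : Module.Basis (Fin (2 + 1)) ℝ (productSegre 2)}
    {A : Fin 2 → ℝ → ℝ} {I : Fin 2 → Set ℝ} (H : IsSmoothOn e A I) (S : Finset (Fin 2))
    (a b : Fin 2 → ℝ) (hS : 2 ≤ S.card) (hb : ∀ j ∈ S, b j ≠ 0)
    (hβ : ((e 0 : productSegre 2) : SegreTensor 2) = ∑ j ∈ S, segreIns j ![a j, b j])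
    (a₁ a₂ : Fin 5 → ℝ) (h1 : ∀ x ∈ I 0, A 0 x = ∑ r : Fin 5, a₁ r * x ^ (r : ℕ))
    (h2 : ∀ x ∈ I 1, A 1 x = ∑ r : Fin 5, a₂ r * x ^ (r : ℕ))
    (k4 : a₂ 4 = -(b 1 ^ 2 / b 0 ^ 2) * a₁ 4)
    (k3 : a₂ 3 = -4 * ((∑ j ∈ S, a j) * b 1 / b 0 ^ 2) * a₁ 4 + b 1 / b 0 * a₁ 3)
    (k2 : a₂ 2 = -6 * ((∑ j ∈ S, a j) ^ 2 / b 0 ^ 2) * a₁ 4 + 3 * ((∑ j ∈ S, a j) / b 0) * a₁ 3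
      - a₁ 2) :
    ∃ η : productSegre 2, ∀ x : Fin 2 → ℝ, (∀ j, x j ∈ I j) →
      extremalDefect e A x = segreMu x η := by
  have hu : S = Finset.univ := Finset.eq_univ_of_card S
    (le_antisymm (Finset.card_le_univ S) (by simpa using hS))
  obtain ⟨e0, es⟩ := segreMu_of_coe_eq_sum hβ
  have es' : ∀ k, segreSlope (e 0) k = b k := fun k => by rw [es k, if_pos (by simp [hu])]
  -- Coefficients indexed by `Fin 5` are extended by zero to `ℕ`.
  have hext : ∀ (f : Fin 5 → ℝ) (x : ℝ), ∑ r : Fin 5, f r * x ^ (r : ℕ) =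
      ∑ r ∈ Finset.range (4 + 1), (fun n => if h : n < 5 then f ⟨n, h⟩ else 0) r * x ^ r :=
    fun f x => by rw [Finset.sum_range]; simp
  refine H.exists_extremalDefect_of_two (by rw [es']; exact hb 0 (by simp [hu]))
    (fun x hx => (h1 x hx).trans (hext a₁ x)) (fun x hx => (h2 x hx).trans (hext a₂ x)) ?_ ?_ ?_
  · rw [es', es']; exact k4
  · rw [es', es', e0]; exact k3
  · rw [es', e0]; exact k2

end IsSmoothOn
end TwistedProduct

theorem mainTheorem3 (m : ℕ) (hm : 2 ≤ m)
    (I : Fin m → Set ℝ) (hIopen : ∀ j, IsOpen (I j)) (hIne : ∀ j, (I j).Nonempty)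
    (hIconn : ∀ j, (I j).OrdConnected)
    (β : productSegre m) (hβ : ∀ x : Fin m → ℝ, (∀ j, x j ∈ I j) → segreMu x β ≠ 0)
    (A : Fin m → ℝ → ℝ) (hAsmooth : ∀ j, ContDiffOn ℝ ∞ (A j) (I j))
    (hA : ∀ j, ∀ x ∈ I j, A j x ≠ 0)
    (e : Module.Basis (Fin (m + 1)) ℝ (productSegre m)) (he : e 0 = β) :
    -- the classification
    (Chart.IsExtremal (TwistedProduct.metric e A) (TwistedProduct.symplecticForm e)
        (TwistedProduct.domain I) ↔
      -- (1) the untwisted case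
      ((∃ t : ℝ, t ≠ 0 ∧ (β : SegreTensor m) = t • PiTensorProduct.tprod ℝ (fun _ => ![1, 0])) ∧
        ∀ i, IsPolynomialOn 3 (A i) (I i)) ∨
      -- (2) the twisting function depends on one variable
      (∃ (j : Fin m) (a b : ℝ), b ≠ 0 ∧ (β : SegreTensor m) = segreIns j ![a, b] ∧
        ∃ γ : Fin 3 → ℝ, OneVariableTwistSolution I A j a b γ) ∨
      -- (3) the twisting function `β₀ + ∑_{j ∈ S} b_j x_j` depends on at least two variables
      (∃ (S : Finset (Fin m)) (a b : Fin m → ℝ), 2 ≤ S.card ∧ (∀ j ∈ S, b j ≠ 0) ∧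
        (β : SegreTensor m) = ∑ j ∈ S, segreIns j ![a j, b j] ∧
        ((m = 2 ∧ ∃ (a₁ a₂ : Fin 5 → ℝ) (β₀ β₁ β₂ : ℝ),
            β₀ = ∑ j ∈ S, a j ∧ β₁ = b ⟨0, by omega⟩ ∧ β₂ = b ⟨1, by omega⟩ ∧
            (∀ x ∈ I ⟨0, by omega⟩, A ⟨0, by omega⟩ x = ∑ r : Fin 5, a₁ r * x ^ (r : ℕ)) ∧
            (∀ x ∈ I ⟨1, by omega⟩, A ⟨1, by omega⟩ x = ∑ r : Fin 5, a₂ r * x ^ (r : ℕ)) ∧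
            a₂ 4 = -(β₂ ^ 2 / β₁ ^ 2) * a₁ 4 ∧
            a₂ 3 = -4 * (β₀ * β₂ / β₁ ^ 2) * a₁ 4 + β₂ / β₁ * a₁ 3 ∧
            a₂ 2 = -6 * (β₀ ^ 2 / β₁ ^ 2) * a₁ 4 + 3 * (β₀ / β₁) * a₁ 3 - a₁ 2) ∨
          (3 ≤ m ∧ (∀ j ∈ S, IsPolynomialOn 1 (A j) (I j)) ∧
            (∀ r ∉ S, IsPolynomialOn 2 (A r) (I r)) ∧
            ∀ x : Fin m → ℝ, (∀ i, x i ∈ I i) →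
              ∑ r ∈ Sᶜ, deriv (deriv (A r)) (x r) = 0)))) ∧
    -- the explicit form of `A_j` in (2)
    (∀ (j : Fin m) (a b : ℝ) (γ : Fin 3 → ℝ), b ≠ 0 →
      (β : SegreTensor m) = segreIns j ![a, b] → OneVariableTwistSolution I A j a b γ →
      ∃ (q : Polynomial ℝ) (ν₀ ν₁ : ℝ), q.natDegree ≤ 2 ∧
        ∀ x ∈ I j, A j x = q.eval x + (a + b * x) ^ (m + 1) * (ν₀ + ν₁ * x)) ∧
    -- the twisting function in (1), and in (2) and (3)
    (∀ t : ℝ, (β : SegreTensor m) = t • PiTensorProduct.tprod ℝ (fun _ => ![1, 0]) ↔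
      ∀ x : Fin m → ℝ, segreMu x β = t) ∧
    (∀ (S : Finset (Fin m)) (a b : Fin m → ℝ),
      (β : SegreTensor m) = ∑ j ∈ S, segreIns j ![a j, b j] ↔
        ∀ x : Fin m → ℝ, segreMu x β = (∑ j ∈ S, a j) + ∑ j ∈ S, b j * x j) := by
  subst he
  have H : TwistedProduct.IsSmoothOn e A I := ⟨hIopen, hIne, hIconn, hβ, hAsmooth, hA⟩
  refine ⟨?_, fun j a b γ hb hj hγ => H.exists_explicit hm hb hj hγ,
    fun t => coe_eq_smul_tprod_iff (by omega) _ t, coe_eq_sum_segreIns_iff _⟩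
  rw [H.isExtremal_iff]
  constructor
  · rintro ⟨η, hη⟩
    exact H.classification_of_extremalDefect_eq _ _ hη
  · rintro (⟨⟨t, -, ht⟩, h3⟩ | ⟨j, a, b, hb, hj, γ, hγ⟩ | ⟨S, a, b, hS, hb, hs, h | h⟩)
    · have h0 := (coe_eq_smul_tprod_iff (by omega) _ t).mp ht
      exact H.exists_extremalDefect_of_const (by omega) (fun k => by simp [segreSlope, h0]) h3
    · exact H.exists_extremalDefect_of_oneVariableTwistSolution hb hj hγ
    · obtain ⟨rfl, a₁, a₂, _, _, _, rfl, rfl, rfl, h1, h2, k4, k3, k2⟩ := h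
      exact H.exists_extremalDefect_of_coeff_two S a b hS hb hs a₁ a₂ h1 h2 k4 k3 k2
    · obtain ⟨-, h1, -, h2⟩ := h
      have es := (segreMu_of_coe_eq_sum hs).2
      exact H.exists_extremalDefect_of_pair (by omega)
        (fun k hk => by rw [es k, if_neg hk]) h1 h2
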